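/- Let $s>5/2$ and $S^1=\mathbb R/\mathbb Z$. Let $H^s_0(S^1)$ be the space of real functions in $H^s(S^1)$ vanishing at $0$, let $\mathrm{Diff}^s_0(S^1)$ be the group of orientation-preserving $H^s$-diffeomorphisms $\varphi$ of $S^1$ with $\varphi(0)=0$, and let $$K^s=\mathrm{Diff}^s_0(S^1)\times\bigl(H^{s-1}(S^1)/\mathbb R\bigr),$$ where $[\alpha]$ denotes the class of $\alpha$ modulo constants. Via $(\varphi,[\alpha])\mapsto(\varphi-\mathrm{id},[\alpha])$, $K^s$ is an open subset of $E=H^s_0(S^1)\times(H^{s-1}(S^1)/\mathbb R)$, and $T_{(\varphi,[\alpha])}K^s=E$. Put $\pi(f)=f-\int_{S^1}f\,dx$ and, for $f$ of zero mean, $(A^{-1}f)(x)=-\int_0^x\!\int_0^y f(z)\,dz\,dy+x\int_{S^1}\!\int_0^y f(z)\,dz\,dy$ (the inverse of $A=-\partial_x^2$). For $u=(u_1,[u_2])$ and $v=(v_1,[v_2])$ in $E$ set $$g_{(\mathrm{id},[0])}(u,v)=\tfrac14\int_{S^1}\bigl(u_{1x}v_{1x}-\pi(u_2)\pi(v_2)\bigr)dx,$$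 $$\Gamma_{(\mathrm{id},[0])}(u,v)=-\tfrac12\Bigl(A^{-1}\partial_x\bigl(u_{1x}v_{1x}-\pi(u_2)\pi(v_2)\bigr),\ \bigl[u_{1x}\pi(v_2)+v_{1x}\pi(u_2)\bigr]\Bigr),$$ and extend both to $K^s$ by right invariance: $$g_{(\varphi,[\alpha])}(U,V)=g_{(\mathrm{id},[0])}(U\circ\varphi^{-1},V\circ\varphi^{-1}),\qquad \Gamma_{(\varphi,[\alpha])}(U,V)=\Gamma_{(\mathrm{id},[0])}(U\circ\varphi^{-1},V\circ\varphi^{-1})\circ\varphi .$$ Let $\nabla_XY=DY\cdot X-\Gamma(Y,X)$. For $U=(U_1,[U_2])$ and $V=(V_1,[V_2])$ in $T_{(\varphi,[\alpha])}K^s$ let $$J(U)=\Bigl(-\int_0^x\bigl(U_2-\textstyle\int_{S^1}U_2\varphi_x\,dz\bigr)\varphi_x\,dy,\ -\Bigl[\dfrac{U_{1x}}{\varphi_x}\Bigr]\Bigr),\qquad \omega(U,V)=\tfrac14\int_{S^1}(U_{2x}V_1-V_{2x}U_1)\,dx .$$ Then $g$, $\Gamma$, $\omega$, $J$ are well-defined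 on $K^s$ and the following hold. (a) $g$ is a smooth (weakly nondegenerate) pseudo-Riemannian metric on $K^s$, and $\nabla$ is a smooth connection compatible with $g$: $X(g(Y,Z))=g(\nabla_XY,Z)+g(Y,\nabla_XZ)$ for all smooth vector fields $X,Y,Z$. (b) $\omega$ is a smooth, closed, (weakly) nondegenerate two-form on $K^s$, and $\nabla\omega=0$. (c) $J$ is a smooth $(1,1)$-tensor on $K^s$ with $J^2=I$ and $\nabla J=0$. (d) $\omega(U,V)=g(JU,V)$. (e) $g(U,V)=-g(JU,JV)$. (f) The Nijenhuis-like tensor $N^J(X,Y)=[X,Y]-J[JX,Y]-J[X,JY]+[JX,JY]$ vanishes for all smooth vector fields $X,Y$ on $K^s$. Here "weakly nondegenerate" means that a tangent vector $U$ with $g(U,V)=0$ (respectively $\omega(U,V)=0$) for all $V$ in the same tangent space is $0$. -/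

import Mathlib

open Set MeasureTheory
open scoped ContDiff

noncomputable section

/-! ### Sobolev spaces on the circle `S¹ = ℝ/ℤ` -/

/-- The `n`-th Fourier coefficient of a real-valued continuous function on the circle. -/
def circleCoeff (f : C(UnitAddCircle, ℝ)) (n : ℤ) : ℂ :=
  fourierCoeff (fun x => (f x : ℂ)) n

theorem circleCoeff_add (f g : C(UnitAddCircle, ℝ)) (n : ℤ) :
    circleCoeff (f + g) n = circleCoeff f n + circleCoeff g n := by
  unfold circleCoeff
  have hi : ∀ h : C(UnitAddCircle, ℝ),
      Integrable (fun x => (h x : ℂ)) AddCircle.haarAddCircle := fun h =>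
    (Complex.continuous_ofReal.comp h.continuous).integrable_of_hasCompactSupport
      (HasCompactSupport.of_compactSpace _)
  have h := congrFun (fourierCoeff.add (hi f) (hi g)) n
  rw [Pi.add_apply] at h
  rw [← h]
  congr 1
  funext x
  simp

theorem circleCoeff_smul (c : ℝ) (f : C(UnitAddCircle, ℝ)) (n : ℤ) :
    circleCoeff (c • f) n = c • circleCoeff f n := by
  unfold circleCoeff
  have h := fourierCoeff.const_mul (fun x => (f x : ℂ)) (c : ℂ) n
  rw [Complex.real_smul, ← h]
  congr 1
  funext x
  simp

theorem circleCoeff_injective {f : C(UnitAddCircle, ℝ)} (h : ∀ n, circleCoeff f n = 0) :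
    f = 0 := by
  let F : C(UnitAddCircle, ℂ) := ⟨fun x => (f x : ℂ), by fun_prop⟩
  have hF : ∀ n, fourierCoeff F n = 0 := h
  have hs : Summable (fourierCoeff F) := by
    have : fourierCoeff F = 0 := funext hF
    rw [this]
    exact summable_zero
  ext x
  have hx := has_pointwise_sum_fourier_series_of_summable hs x
  simp only [hF, zero_smul] at hx
  have := hx.unique hasSum_zero
  simpa [F] using this

/-- The weighted Fourier coefficients `(1 + n²)^(r/2) f̂(n)`. -/
def weightedCoeff (r : ℝ) (f : C(UnitAddCircle, ℝ)) (n : ℤ) : ℂ :=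
  ((1 + (n : ℝ) ^ 2) ^ (r / 2) : ℝ) • circleCoeff f n

/-- The functions of Sobolev class `H^r`: those with `∑ (1 + n²)^r |f̂(n)|² < ∞`. For `r > 1/2`, the
only range in which this is used, every `L²` class of this kind has exactly one continuous
representative, so that `H^r(S¹)` is a space of continuous functions. -/
def sobolevSubmodule (r : ℝ) : Submodule ℝ C(UnitAddCircle, ℝ) where
  carrier := {f | Memℓp (weightedCoeff r f) 2}
  zero_mem' := by
    have : weightedCoeff r 0 = 0 := by
      funext n
      have := circleCoeff_smul 0 0 n
      simp only [zero_smul] at this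
      simp [weightedCoeff, this]
    simp only [mem_ofPred_eq, this]
    exact zero_memℓp
  add_mem' := by
    intro f g hf hg
    have : weightedCoeff r (f + g) = weightedCoeff r f + weightedCoeff r g := by
      funext n
      simp only [weightedCoeff, circleCoeff_add, smul_add, Pi.add_apply]
    simp only [mem_ofPred_eq, this] at *
    exact hf.add hg
  smul_mem' := by
    intro c f hf
    have : weightedCoeff r (c • f) = c • weightedCoeff r f := by
      funext n
      simp only [weightedCoeff, circleCoeff_smul, Pi.smul_apply]
      rw [smul_comm]
    simp only [mem_ofPred_eq, this] at *
    exact hf.const_smul c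

/-- The Sobolev space `H^r(S¹)` of real-valued functions on the circle, as a type of its own: its
norm is the Sobolev norm below, not the supremum norm. -/
def SobolevH (r : ℝ) : Type := sobolevSubmodule r

instance (r : ℝ) : AddCommGroup (SobolevH r) :=
  inferInstanceAs (AddCommGroup (sobolevSubmodule r))

instance (r : ℝ) : Module ℝ (SobolevH r) :=
  inferInstanceAs (Module ℝ (sobolevSubmodule r))

/-- The isometric embedding `f ↦ ((1 + n²)^(r/2) f̂(n))ₙ` of `H^r(S¹)` into `ℓ²(ℤ)`. -/
def sobolevToLp (r : ℝ) : SobolevH r →ₗ[ℝ] lp (fun _ : ℤ => ℂ) 2 where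
  toFun f := ⟨weightedCoeff r f.1, f.2⟩
  map_add' f g := by
    ext n
    change weightedCoeff r (f.1 + g.1) n = weightedCoeff r f.1 n + weightedCoeff r g.1 n
    simp only [weightedCoeff, circleCoeff_add, smul_add]
  map_smul' c f := by
    ext n
    change weightedCoeff r (c • f.1) n = c • weightedCoeff r f.1 n
    simp only [weightedCoeff, circleCoeff_smul]
    rw [smul_comm]

theorem sobolevToLp_injective (r : ℝ) : Function.Injective (sobolevToLp r) := by
  rw [← LinearMap.ker_eq_bot, LinearMap.ker_eq_bot']
  intro f hf
  apply Subtype.ext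
  apply circleCoeff_injective
  intro n
  have h : weightedCoeff r f.1 n = 0 :=
    congrFun (congrArg (fun u : lp (fun _ : ℤ => ℂ) 2 => (u : ℤ → ℂ)) hf) n
  have hpos : (0 : ℝ) < (1 + (n : ℝ) ^ 2) ^ (r / 2) := by positivity
  exact (smul_eq_zero.mp h).resolve_left hpos.ne'

/-- The Sobolev norm `‖f‖² = ∑ (1 + n²)^r |f̂(n)|²`. -/
instance (r : ℝ) : NormedAddCommGroup (SobolevH r) :=
  NormedAddCommGroup.induced (SobolevH r) (lp (fun _ : ℤ => ℂ) 2) (sobolevToLp r)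
    (sobolevToLp_injective r)

instance (r : ℝ) : NormedSpace ℝ (SobolevH r) :=
  NormedSpace.induced ℝ (SobolevH r) (lp (fun _ : ℤ => ℂ) 2) (sobolevToLp r)

/-- An element of `H^r(S¹)` regarded as a `1`-periodic function on the line. -/
def SobolevH.per {r : ℝ} (f : SobolevH r) (x : ℝ) : ℝ := f.1 (x : UnitAddCircle)

/-- The subspace `H^r_0(S¹)` of functions vanishing at `0`. -/
def sobolevZero (r : ℝ) : Submodule ℝ (SobolevH r) where
  carrier := {f | f.per 0 = 0}
  zero_mem' := rfl
  add_mem' := by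
    intro f g hf hg
    change f.per 0 + g.per 0 = 0
    simp only [mem_ofPred_eq] at hf hg
    rw [hf, hg, add_zero]
  smul_mem' := by
    intro c f hf
    change c * f.per 0 = 0
    simp only [mem_ofPred_eq] at hf
    rw [hf, mul_zero]

/-- The subspace of constant functions. -/
def sobolevConst (r : ℝ) : Submodule ℝ (SobolevH r) where
  carrier := {f | ∃ c : ℝ, ∀ x, f.per x = c}
  zero_mem' := ⟨0, fun _ => rfl⟩
  add_mem' := by
    rintro f g ⟨c, hc⟩ ⟨d, hd⟩
    refine ⟨c + d, fun x => ?_⟩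
    change f.per x + g.per x = c + d
    rw [hc, hd]
  smul_mem' := by
    rintro a f ⟨c, hc⟩
    refine ⟨a * c, fun x => ?_⟩
    change a * f.per x = a * c
    rw [hc]

theorem SobolevH.per_injective {r : ℝ} {f g : SobolevH r} (h : ∀ x, f.per x = g.per x) :
    f = g := by
  apply Subtype.ext
  ext x
  induction x using QuotientAddGroup.induction_on with
  | H x => exact h x

instance (r : ℝ) : FiniteDimensional ℝ (sobolevConst r) := by
  let L : sobolevConst r →ₗ[ℝ] ℝ :=
    { toFun := fun f => f.1.per 0
      map_add' := fun _ _ => rfl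
      map_smul' := fun _ _ => rfl }
  refine FiniteDimensional.of_injective L ?_
  rintro ⟨f, c, hc⟩ ⟨g, d, hd⟩ h
  have h' : f.per 0 = g.per 0 := h
  rw [hc, hd] at h'
  apply Subtype.ext
  apply SobolevH.per_injective
  intro x
  change f.per x = g.per x
  rw [hc, hd, h']

instance (r : ℝ) : IsClosed (sobolevConst r : Set (SobolevH r)) :=
  Submodule.closed_of_finiteDimensional _

/-! ### The manifold `K^s` -/

/-- The model space `H^s_0(S¹) × (H^{s-1}(S¹)/ℝ)`, which is also every tangent space of `K^s`. -/
def KModel (s : ℝ) : Type := sobolevZero s × (SobolevH (s - 1) ⧸ sobolevConst (s - 1))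

instance (s : ℝ) : NormedAddCommGroup (KModel s) :=
  inferInstanceAs (NormedAddCommGroup (sobolevZero s × (SobolevH (s - 1) ⧸ sobolevConst (s - 1))))

instance (s : ℝ) : NormedSpace ℝ (KModel s) :=
  inferInstanceAs (NormedSpace ℝ (sobolevZero s × (SobolevH (s - 1) ⧸ sobolevConst (s - 1))))

/-- The vector `(U₁, [U₂])`. -/
def KModel.mk {s : ℝ} (U₁ : sobolevZero s) (U₂ : SobolevH (s - 1)) : KModel s :=
  (U₁, Submodule.Quotient.mk U₂)

/-- The lift `φ(x) = x + f(x)` to the line of the circle map encoded by the first component `f`. -/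
def KModel.phi {s : ℝ} (p : KModel s) (x : ℝ) : ℝ := x + p.1.1.per x

/-- `K^s = Diff^s_0(S¹) ⋉ (H^{s-1}(S¹)/ℝ)` in its global chart. An orientation-preserving
diffeomorphism `φ` of class `H^s` with `φ(0) = 0` is `φ = id + f` with `f ∈ H^s_0(S¹)` and `φ_x > 0`;
the chart maps `(φ, [α])` to `(φ - id, [α])`. -/
def Kspace (s : ℝ) : Set (KModel s) := {p | ∀ x : ℝ, 0 < deriv p.phi x}

/-- The vector `W = (W₁, [W₂])` has first component the function `w₁`, and second component the
class modulo constants of the function `w₂`. -/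
def KModel.IsPair {s : ℝ} (W : KModel s) (w₁ w₂ : ℝ → ℝ) : Prop :=
  (∀ x, W.1.1.per x = w₁ x) ∧
    ∃ W₂ : SobolevH (s - 1), Submodule.Quotient.mk W₂ = W.2 ∧ ∀ x, W₂.per x = w₂ x

/-! ### Operations on `1`-periodic functions on the line, and the tensors at the identity -/

/-- `π(f) = f - ∫_{S¹} f dx`. -/
def meanFree (f : ℝ → ℝ) (x : ℝ) : ℝ := f x - ∫ y in (0 : ℝ)..1, f y

/-- The inverse of `A = -∂ₓ²`, on functions of zero mean:
`(A⁻¹ f)(x) = - ∫₀ˣ ∫₀ʸ f(z) dz dy + x ∫_{S¹} ∫₀ʸ f(z) dz dy`. -/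
def invA (f : ℝ → ℝ) (x : ℝ) : ℝ :=
  -(∫ y in (0 : ℝ)..x, ∫ z in (0 : ℝ)..y, f z) + x * ∫ y in (0 : ℝ)..1, ∫ z in (0 : ℝ)..y, f z

/-- The metric at the identity: `¼ ∫ (u₁ₓ v₁ₓ - π(u₂) π(v₂)) dx`. -/
def metricId (u₁ u₂ v₁ v₂ : ℝ → ℝ) : ℝ :=
  1 / 4 * ∫ x in (0 : ℝ)..1, (deriv u₁ x * deriv v₁ x - meanFree u₂ x * meanFree v₂ x)

/-- First component of the Christoffel map at the identity:
`-½ A⁻¹ ∂ₓ (u₁ₓ v₁ₓ - π(u₂) π(v₂))`. -/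
def christoffelId₁ (u₁ u₂ v₁ v₂ : ℝ → ℝ) (x : ℝ) : ℝ :=
  -(1 / 2) * invA (deriv fun y => deriv u₁ y * deriv v₁ y - meanFree u₂ y * meanFree v₂ y) x

/-- Representative of the second component of the Christoffel map at the identity:
`-½ (u₁ₓ π(v₂) + v₁ₓ π(u₂))`. -/
def christoffelId₂ (u₁ u₂ v₁ v₂ : ℝ → ℝ) (x : ℝ) : ℝ :=
  -(1 / 2) * (deriv u₁ x * meanFree v₂ x + deriv v₁ x * meanFree u₂ x)

/-! ### The tensors on `K^s` -/

/-- `U ∘ φ⁻¹`. -/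
def compInv (U φ : ℝ → ℝ) : ℝ → ℝ := U ∘ Function.invFun φ

/-- `g` is on `K^s` the right-invariant extension of the metric at the identity. -/
def IsKMetric (s : ℝ) (g : KModel s → KModel s →L[ℝ] KModel s →L[ℝ] ℝ) : Prop :=
  ∀ p ∈ Kspace s, ∀ (U₁ V₁ : sobolevZero s) (U₂ V₂ : SobolevH (s - 1)),
    g p (KModel.mk U₁ U₂) (KModel.mk V₁ V₂) =
      metricId (compInv U₁.1.per p.phi) (compInv U₂.per p.phi)
        (compInv V₁.1.per p.phi) (compInv V₂.per p.phi)

/-- `Γ` is on `K^s` the right-invariant extension of the Christoffel map at the identity: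
`Γ_{(φ,[α])}(U, V) = Γ_{(id,[0])}(U ∘ φ⁻¹, V ∘ φ⁻¹) ∘ φ`. -/
def IsKChristoffel (s : ℝ) (Γ : KModel s → KModel s →L[ℝ] KModel s →L[ℝ] KModel s) : Prop :=
  ∀ p ∈ Kspace s, ∀ (U₁ V₁ : sobolevZero s) (U₂ V₂ : SobolevH (s - 1)),
    (Γ p (KModel.mk U₁ U₂) (KModel.mk V₁ V₂)).IsPair
      (christoffelId₁ (compInv U₁.1.per p.phi) (compInv U₂.per p.phi)
        (compInv V₁.1.per p.phi) (compInv V₂.per p.phi) ∘ p.phi)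
      (christoffelId₂ (compInv U₁.1.per p.phi) (compInv U₂.per p.phi)
        (compInv V₁.1.per p.phi) (compInv V₂.per p.phi) ∘ p.phi)

/-- `J_{(φ,[α])}(U₁, [U₂]) = (-∫₀ˣ π(U₂) φₓ dy, -[U₁ₓ / φₓ])` on `K^s`, where, at the point
`(φ, [α])`, `π(U₂) = U₂ - ∫_{S¹} U₂ φₓ dx`. -/
def IsKTensorJ (s : ℝ) (J : KModel s → KModel s →L[ℝ] KModel s) : Prop :=
  ∀ p ∈ Kspace s, ∀ (U₁ : sobolevZero s) (U₂ : SobolevH (s - 1)),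
    (J p (KModel.mk U₁ U₂)).IsPair
      (fun x => -∫ y in (0 : ℝ)..x,
        (U₂.per y - ∫ z in (0 : ℝ)..1, U₂.per z * deriv p.phi z) * deriv p.phi y)
      (fun x => -(deriv U₁.1.per x / deriv p.phi x))

/-- `ω_{(φ,[α])}((U₁, [U₂]), (V₁, [V₂])) = ¼ ∫ (U₂ₓ V₁ - V₂ₓ U₁) dx` on `K^s`. -/
def IsKForm (s : ℝ) (Ω : KModel s → KModel s [⋀^Fin 2]→L[ℝ] ℝ) : Prop :=
  ∀ p ∈ Kspace s, ∀ (U₁ V₁ : sobolevZero s) (U₂ V₂ : SobolevH (s - 1)),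
    Ω p ![KModel.mk U₁ U₂, KModel.mk V₁ V₂] =
      1 / 4 * ∫ x in (0 : ℝ)..1, (deriv U₂.per x * V₁.1.per x - deriv V₂.per x * U₁.1.per x)

/-! ### Differential geometry on an open subset `K` of a normed space `E` -/

/-- A smooth vector field on `K`. -/
def IsSmoothField {E : Type*} [NormedAddCommGroup E] [NormedSpace ℝ E] (K : Set E)
    (X : E → E) : Prop := ContDiffOn ℝ ∞ X K

/-- The covariant derivative `∇_X Y = DY · X - Γ(Y, X)`. -/
def covDeriv {E : Type*} [NormedAddCommGroup E] [NormedSpace ℝ E]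
    (Γ : E → E →L[ℝ] E →L[ℝ] E) (X Y : E → E) (p : E) : E :=
  fderiv ℝ Y p (X p) - Γ p (Y p) (X p)

/-- A smooth (weakly nondegenerate) pseudo-Riemannian metric on `K`. -/
structure IsPseudoRiemannianMetric {E : Type*} [NormedAddCommGroup E] [NormedSpace ℝ E]
    (K : Set E) (g : E → E →L[ℝ] E →L[ℝ] ℝ) : Prop where
  smooth : ContDiffOn ℝ ∞ g K
  symm : ∀ p ∈ K, ∀ U V, g p U V = g p V U
  nondegenerate : ∀ p ∈ K, ∀ U, (∀ V, g p U V = 0) → U = 0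

/-- `∇ g = 0`, that is, `X (g(Y, Z)) = g(∇_X Y, Z) + g(Y, ∇_X Z)` for all vector fields. -/
def IsMetricCompatible {E : Type*} [NormedAddCommGroup E] [NormedSpace ℝ E] (K : Set E)
    (Γ : E → E →L[ℝ] E →L[ℝ] E) (g : E → E →L[ℝ] E →L[ℝ] ℝ) : Prop :=
  ∀ X Y Z : E → E, IsSmoothField K X → IsSmoothField K Y → IsSmoothField K Z → ∀ p ∈ K,
    fderiv ℝ (fun q => g q (Y q) (Z q)) p (X p) =
      g p (covDeriv Γ X Y p) (Z p) + g p (Y p) (covDeriv Γ X Z p)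

/-- A smooth, closed, (weakly) nondegenerate two-form on `K`. -/
structure IsSymplecticForm {E : Type*} [NormedAddCommGroup E] [NormedSpace ℝ E]
    (K : Set E) (Ω : E → E [⋀^Fin 2]→L[ℝ] ℝ) : Prop where
  smooth : ContDiffOn ℝ ∞ Ω K
  closed : ∀ p ∈ K, extDeriv Ω p = 0
  nondegenerate : ∀ p ∈ K, ∀ U, (∀ V, Ω p ![U, V] = 0) → U = 0

/-- `∇ ω = 0`, that is, `X (ω(Y, Z)) = ω(∇_X Y, Z) + ω(Y, ∇_X Z)` for all vector fields. -/
def IsParallelForm {E : Type*} [NormedAddCommGroup E] [NormedSpace ℝ E] (K : Set E)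
    (Γ : E → E →L[ℝ] E →L[ℝ] E) (Ω : E → E [⋀^Fin 2]→L[ℝ] ℝ) : Prop :=
  ∀ X Y Z : E → E, IsSmoothField K X → IsSmoothField K Y → IsSmoothField K Z → ∀ p ∈ K,
    fderiv ℝ (fun q => Ω q ![Y q, Z q]) p (X p) =
      Ω p ![covDeriv Γ X Y p, Z p] + Ω p ![Y p, covDeriv Γ X Z p]

/-- `∇ J = 0`, that is, `∇_X (J Y) = J (∇_X Y)` for all vector fields. -/
def IsParallelTensor {E : Type*} [NormedAddCommGroup E] [NormedSpace ℝ E] (K : Set E)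
    (Γ : E → E →L[ℝ] E →L[ℝ] E) (J : E → E →L[ℝ] E) : Prop :=
  ∀ X Y : E → E, IsSmoothField K X → IsSmoothField K Y → ∀ p ∈ K,
    covDeriv Γ X (fun q => J q (Y q)) p = J p (covDeriv Γ X Y p)

/-- The Nijenhuis-like tensor `N^J(X, Y) = [X, Y] - J[JX, Y] - J[X, JY] + [JX, JY]`. -/
def nijenhuis {E : Type*} [NormedAddCommGroup E] [NormedSpace ℝ E]
    (J : E → E →L[ℝ] E) (X Y : E → E) (p : E) : E :=
  VectorField.lieBracket ℝ X Y p
    - J p (VectorField.lieBracket ℝ (fun q => J q (X q)) Y p)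
    - J p (VectorField.lieBracket ℝ X (fun q => J q (Y q)) p)
    + VectorField.lieBracket ℝ (fun q => J q (X q)) (fun q => J q (Y q)) p

end

noncomputable section

open Filter Topology

/-! ### Fourier coefficients and membership in Sobolev spaces -/

/-! Describe a tangent vector U at (φ, [α]) by a = U₁ₓ and b = U₂ - ∫ U₂ φₓ, both in H^{s-1}; a and
φₓ b have mean zero, and (a, b) determines U. Composition with φ⁻¹ is not smooth in φ for the
Sobolev topology, but the substitution y = φ(x) removes it from the right-invariant formulas. With
indices for the two arguments, g = ¼ ∫ (a a'/φₓ - φₓ b b'), ω = ¼ ∫ (a b' - b a'), and J is the swap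
(a, b) ↦ (-φₓ b, -a/φₓ); Γ takes a similar form.

Only products, means, primitives and 1/φₓ remain. Smoothness therefore rests on two facts about
H^{s-1}: multiplication is continuous (`SobolevH.mulL`), and f ↦ 1/f is smooth at nowhere vanishing
f (`SobolevH.contDiffAt_inv`). The proof of the second uses s - 1 > 3/2.

In ω the dependence on φ cancels, because adding a constant to b pairs with a mean-zero a
(`KModel.formBilin_eq`). So ω is constant in the chart, hence closed. The swap gives J² = I and g =
ω(J·, ·), from which (d), (e) and the nondegeneracy of g follow. Since ω is constant, ∇ω = 0 is the
symmetry in Y, Z of a cubic integrand (`KModel.formBilin_christoffel_add`), and ∇J = 0 is an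
identity between DJ, J and Γ (`KModel.fderiv_tensorJ`). The rest is formal: ∇ω = 0 and ∇J = 0 give
metric compatibility, and the symmetry of Γ together with ∇J = 0 and J² = I gives N^J = 0. -/

theorem norm_weightedCoeff_sq (r : ℝ) (f : C(UnitAddCircle, ℝ)) (n : ℤ) :
    ‖weightedCoeff r f n‖ ^ 2 = (1 + (n : ℝ) ^ 2) ^ r * ‖circleCoeff f n‖ ^ 2 := by
  have h : (0 : ℝ) < 1 + (n : ℝ) ^ 2 := by positivity
  rw [weightedCoeff, norm_smul, mul_pow, Real.norm_of_nonneg (by positivity), ← Real.rpow_natCast,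
    ← Real.rpow_mul h.le]
  congr 2
  push_cast
  ring

theorem mem_sobolevSubmodule_iff {r : ℝ} {f : C(UnitAddCircle, ℝ)} :
    f ∈ sobolevSubmodule r ↔
      Summable fun n : ℤ => (1 + (n : ℝ) ^ 2) ^ r * ‖circleCoeff f n‖ ^ 2 := by
  change Memℓp (weightedCoeff r f) 2 ↔ _
  rw [memℓp_gen_iff (by norm_num)]
  simp only [← norm_weightedCoeff_sq]
  norm_num

/-- An element of `H^r(S¹)` from a continuous function satisfying the Sobolev condition. -/
def SobolevH.of {r : ℝ} (f : C(UnitAddCircle, ℝ)) (hf : f ∈ sobolevSubmodule r) : SobolevH r :=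
  ⟨f, hf⟩

theorem SobolevH.norm_sq {r : ℝ} (f : SobolevH r) :
    ‖f‖ ^ 2 = ∑' n : ℤ, (1 + (n : ℝ) ^ 2) ^ r * ‖circleCoeff f.1 n‖ ^ 2 := by
  change ‖sobolevToLp r f‖ ^ 2 = _
  have h := lp.norm_rpow_eq_tsum (p := 2) (by norm_num) (sobolevToLp r f)
  simp only [← norm_weightedCoeff_sq]
  norm_num at h
  exact h

/-- Comparison with |n|^(-2r), valid for n ≠ 0 only; one exceptional index does no harm. -/
theorem summable_sobolevWeight {r : ℝ} (hr : 1 / 2 < r) :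
    Summable fun n : ℤ => (1 + (n : ℝ) ^ 2) ^ (-r) := by
  refine (Real.summable_abs_int_rpow (b := 2 * r) (by linarith)).of_norm_bounded_eventually ?_
  refine (Set.finite_singleton (0 : ℤ)).subset fun n hn => ?_
  by_contra h0
  refine hn ?_
  have h1 : (0 : ℝ) < |(n : ℝ)| := abs_pos.mpr (Int.cast_ne_zero.mpr h0)
  change ‖(1 + (n : ℝ) ^ 2) ^ (-r)‖ ≤ |(n : ℝ)| ^ (-(2 * r))
  rw [Real.norm_of_nonneg (by positivity),
    show -(2 * r) = (2 : ℕ) * (-r) by push_cast; ring, Real.rpow_mul h1.le, Real.rpow_natCast, sq_abs]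
  refine Real.rpow_le_rpow_of_nonpos ?_ (by linarith) (by linarith)
  rw [← sq_abs]
  positivity

theorem sobolevWeight_mul_self (r : ℝ) (n : ℤ) :
    ((1 + (n : ℝ) ^ 2) ^ (-r / 2)) ^ 2 = (1 + (n : ℝ) ^ 2) ^ (-r) := by
  rw [← Real.rpow_natCast, ← Real.rpow_mul (by positivity)]
  congr 1
  push_cast
  ring

theorem norm_circleCoeff_eq (r : ℝ) (f : C(UnitAddCircle, ℝ)) (n : ℤ) :
    ‖circleCoeff f n‖ = (1 + (n : ℝ) ^ 2) ^ (-r / 2) * ‖weightedCoeff r f n‖ := by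
  have h : (0 : ℝ) < 1 + (n : ℝ) ^ 2 := by positivity
  rw [weightedCoeff, norm_smul, Real.norm_of_nonneg (by positivity), ← mul_assoc,
    ← Real.rpow_add h, show -r / 2 + r / 2 = 0 by ring, Real.rpow_zero, one_mul]

/-- Cauchy–Schwarz between (1 + n²)^(-r/2) and the weighted coefficients. It yields both absolute
convergence of the Fourier series and the embedding into continuous functions. -/
theorem SobolevH.summable_and_tsum_norm_circleCoeff_le {r : ℝ} (hr : 1 / 2 < r) (f : SobolevH r) :
    (Summable fun n => ‖circleCoeff f.1 n‖) ∧
      ∑' n, ‖circleCoeff f.1 n‖ ≤ √(∑' n : ℤ, (1 + (n : ℝ) ^ 2) ^ (-r)) * ‖f‖ := by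
  have h := Real.summable_and_inner_le_Lp_mul_Lq_tsum_of_nonneg
    (f := fun n : ℤ => (1 + (n : ℝ) ^ 2) ^ (-r / 2)) (g := fun n => ‖weightedCoeff r f.1 n‖)
    Real.HolderConjugate.two_two (fun n => by positivity) (fun n => norm_nonneg _)
    (by simpa [sobolevWeight_mul_self] using summable_sobolevWeight hr)
    (by simpa [norm_weightedCoeff_sq] using mem_sobolevSubmodule_iff.mp f.2)
  simp only [← norm_circleCoeff_eq, Real.rpow_two, sobolevWeight_mul_self,
    norm_weightedCoeff_sq, ← SobolevH.norm_sq, ← Real.sqrt_eq_rpow, Real.sqrt_sq (norm_nonneg f)] at h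
  exact h

theorem summable_norm_circleCoeff {r : ℝ} (hr : 1 / 2 < r) {f : C(UnitAddCircle, ℝ)}
    (hf : f ∈ sobolevSubmodule r) : Summable fun n => ‖circleCoeff f n‖ :=
  (SobolevH.summable_and_tsum_norm_circleCoeff_le hr ⟨f, hf⟩).1

/-- The complexification of a real continuous function on the circle. -/
def circleComplex (f : C(UnitAddCircle, ℝ)) : C(UnitAddCircle, ℂ) :=
  ⟨fun x => (f x : ℂ), by fun_prop⟩

theorem hasSum_circleCoeff {f : C(UnitAddCircle, ℝ)} (hf : Summable fun n => ‖circleCoeff f n‖)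
    (x : UnitAddCircle) : HasSum (fun n => circleCoeff f n * fourier n x) (f x : ℂ) :=
  has_pointwise_sum_fourier_series_of_summable (f := circleComplex f) hf.of_norm x

theorem norm_fourier_apply (n : ℤ) (x : UnitAddCircle) : ‖fourier n x‖ = 1 := by
  rw [fourier_apply, Circle.norm_coe]

theorem abs_apply_le_tsum {f : C(UnitAddCircle, ℝ)} (hf : Summable fun n => ‖circleCoeff f n‖)
    (x : UnitAddCircle) : |f x| ≤ ∑' n, ‖circleCoeff f n‖ := by
  have hx : ∀ n, ‖circleCoeff f n * fourier n x‖ = ‖circleCoeff f n‖ := fun n => by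
    rw [norm_mul, norm_fourier_apply, mul_one]
  have h := norm_tsum_le_tsum_norm (f := fun n => circleCoeff f n * fourier n x) 
    (by simpa only [hx])
  rw [(hasSum_circleCoeff hf x).tsum_eq] at h
  simpa only [hx, Complex.norm_real, Real.norm_eq_abs] using h

theorem SobolevH.norm_toContinuousMap_le {r : ℝ} (hr : 1 / 2 < r) (f : SobolevH r) :
    ‖f.1‖ ≤ √(∑' n : ℤ, (1 + (n : ℝ) ^ 2) ^ (-r)) * ‖f‖ := by
  obtain ⟨h1, h2⟩ := f.summable_and_tsum_norm_circleCoeff_le hr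
  rw [ContinuousMap.norm_le _ (by positivity)]
  exact fun x => (abs_apply_le_tsum h1 x).trans h2

theorem integrable_circle (f : C(UnitAddCircle, ℂ)) : Integrable f AddCircle.haarAddCircle :=
  f.continuous.integrable_of_hasCompactSupport (HasCompactSupport.of_compactSpace _)

theorem norm_circleCoeff_le (f : C(UnitAddCircle, ℝ)) (n : ℤ) : ‖circleCoeff f n‖ ≤ ‖f‖ := by
  unfold circleCoeff fourierCoeff
  have := norm_integral_le_of_norm_le_const (μ := AddCircle.haarAddCircle (T := (1 : ℝ)))
    (f := fun t : UnitAddCircle => fourier (-n) t • (f t : ℂ)) (C := ‖f‖)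
    (Eventually.of_forall fun t => by
      rw [norm_smul, norm_fourier_apply, one_mul, Complex.norm_real]
      exact f.norm_coe_le_norm t)
  simpa using this

theorem continuous_circleCoeff (n : ℤ) : Continuous fun f : C(UnitAddCircle, ℝ) => circleCoeff f n :=
  let L : C(UnitAddCircle, ℝ) →ₗ[ℝ] ℂ :=
    { toFun := fun f => circleCoeff f n
      map_add' := fun f g => circleCoeff_add f g n
      map_smul' := fun c f => circleCoeff_smul c f n }
  (L.mkContinuous 1 fun f => (norm_circleCoeff_le f n).trans_eq (one_mul _).symm).continuous

/-- The Sobolev embedding `H^r(S¹) ⊆ C(S¹)` for `r > 1/2`. -/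
def sobolevToContinuousMap {r : ℝ} (hr : 1 / 2 < r) : SobolevH r →L[ℝ] C(UnitAddCircle, ℝ) :=
  LinearMap.mkContinuous
    { toFun := fun f => f.1
      map_add' := fun _ _ => rfl
      map_smul' := fun _ _ => rfl } _ (SobolevH.norm_toContinuousMap_le hr)

theorem SobolevH.isometry_toLp (r : ℝ) : Isometry (sobolevToLp r) :=
  AddMonoidHomClass.isometry_of_norm (sobolevToLp r) fun _ => rfl

/-- A Cauchy sequence has an ℓ² limit of weighted coefficients and, by the Sobolev embedding, a
uniform limit. Each coefficient is continuous for both, so the two limits match. -/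
theorem SobolevH.completeSpace {r : ℝ} (hr : 1 / 2 < r) : CompleteSpace (SobolevH r) := by
  refine Metric.complete_of_cauchySeq_tendsto fun u hu => ?_
  obtain ⟨a, ha⟩ := cauchySeq_tendsto_of_complete
    ((SobolevH.isometry_toLp r).uniformContinuous.comp_cauchySeq hu)
  obtain ⟨f, hf⟩ := cauchySeq_tendsto_of_complete
    ((sobolevToContinuousMap hr).uniformContinuous.comp_cauchySeq hu)
  have hfa : weightedCoeff r f = a := by
    funext n
    refine tendsto_nhds_unique (f := fun k => weightedCoeff r (u k).1 n) ?_
      ((lp.uniformContinuous_coe (p := 2)).continuous.tendsto a |>.comp ha |>.apply_nhds n)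
    exact (((continuous_circleCoeff n).tendsto f).comp hf).const_smul _
  have hmem : f ∈ sobolevSubmodule r := by
    change Memℓp (weightedCoeff r f) 2
    rw [hfa]
    exact lp.memℓp a
  refine ⟨SobolevH.of f hmem, ?_⟩
  rw [(SobolevH.isometry_toLp r).isEmbedding.tendsto_nhds_iff]
  convert ha
  exact lp.ext hfa

theorem sobolevSubmodule_anti {a b : ℝ} (hab : a ≤ b) : sobolevSubmodule b ≤ sobolevSubmodule a := by
  intro f hf
  rw [mem_sobolevSubmodule_iff] at hf ⊢
  refine hf.of_nonneg_of_le (fun n => by positivity) fun n => ?_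
  gcongr
  nlinarith [sq_nonneg (n : ℝ)]

/-- Parseval. This starts the regularity bootstrap for inverses. -/
theorem mem_sobolevSubmodule_zero (f : C(UnitAddCircle, ℝ)) : f ∈ sobolevSubmodule 0 := by
  rw [mem_sobolevSubmodule_iff]
  have h := (hasSum_sq_fourierCoeff
    (ContinuousMap.toLp (E := ℂ) 2 AddCircle.haarAddCircle ℂ (circleComplex f))).summable
  simp only [fourierCoeff_toLp] at h
  simpa [circleCoeff, circleComplex] using h

/-! ### Products of Sobolev functions -/

/-- Young's inequality ℓ¹ * ℓ² ⊆ ℓ², by Cauchy–Schwarz after splitting b = √b · √b. -/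
theorem summable_sq_convolution {a b : ℤ → ℝ} (ha : ∀ n, 0 ≤ a n) (hb : ∀ n, 0 ≤ b n)
    (ha2 : Summable fun n => a n ^ 2) (hbs : Summable b) :
    (∀ n, Summable fun m => b m * a (n - m)) ∧ Summable fun n => (∑' m, b m * a (n - m)) ^ 2 := by
  have h2 : Summable fun x : ℤ × ℤ => b x.1 * a x.2 ^ 2 :=
    hbs.mul_of_nonneg ha2 hb fun n => sq_nonneg _
  -- The shear turning the product family into the convolution family.
  let e : ℤ × ℤ ≃ ℤ × ℤ :=
    { toFun := fun x => (x.2, x.1 - x.2)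
      invFun := fun x => (x.1 + x.2, x.1)
      left_inv := fun x => by simp
      right_inv := fun x => by simp }
  have h3 : Summable fun x : ℤ × ℤ => b x.2 * a (x.1 - x.2) ^ 2 := (e.summable_iff).mpr h2
  have h4 : ∀ n, Summable fun m => b m * a (n - m) ^ 2 := fun n => h3.prod_factor n
  have h5 : ∀ n, (Summable fun m => b m * a (n - m)) ∧
      ∑' m, b m * a (n - m) ≤ √(∑' m, b m) * √(∑' m, b m * a (n - m) ^ 2) := by
    intro n
    have hl : ∀ m, √(b m) ^ 2 = b m := fun m => Real.sq_sqrt (hb m)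
    have h := Real.summable_and_inner_le_Lp_mul_Lq_tsum_of_nonneg
      (f := fun m => √(b m)) (g := fun m => √(b m) * a (n - m))
      Real.HolderConjugate.two_two (fun m => Real.sqrt_nonneg _)
      (fun m => mul_nonneg (Real.sqrt_nonneg _) (ha _))
      (by simpa [hl] using hbs) (by simpa [hl, mul_pow] using h4 n)
    simpa only [← mul_assoc, ← sq, hl, Real.rpow_two, mul_pow, ← Real.sqrt_eq_rpow] using h
  refine ⟨fun n => (h5 n).1, ?_⟩
  refine ((h3.prod).mul_left (∑' m, b m)).of_nonneg_of_le (fun n => sq_nonneg _) fun n => ?_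
  have h6 := pow_le_pow_left₀ (tsum_nonneg fun m => mul_nonneg (hb m) (ha _)) (h5 n).2 2
  rwa [mul_pow, Real.sq_sqrt (tsum_nonneg hb),
    Real.sq_sqrt (tsum_nonneg fun m => mul_nonneg (hb m) (sq_nonneg _))] at h6

/-- Insert the absolutely convergent Fourier series of f and integrate term by term. -/
theorem hasSum_circleCoeff_mul {f g : C(UnitAddCircle, ℝ)}
    (hf : Summable fun n => ‖circleCoeff f n‖) (n : ℤ) :
    HasSum (fun m => circleCoeff f m * circleCoeff g (n - m)) (circleCoeff (f * g) n) := by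
  let F : ℤ → C(UnitAddCircle, ℂ) := fun m =>
    circleCoeff f m • (fourier (-(n - m)) * circleComplex g)
  have hF : ∀ m t, F m t = circleCoeff f m * fourier m t * (fourier (-n) t * (g t : ℂ)) := by
    intro m t
    simp only [F, ContinuousMap.smul_apply, ContinuousMap.mul_apply, smul_eq_mul,
      show -(n - m) = m + -n by ring, fourier_add, circleComplex, ContinuousMap.coe_mk]
    ring
  have h := hasSum_integral_of_summable_integral_norm (μ := AddCircle.haarAddCircle (T := (1 : ℝ)))
    (F := fun m t => F m t) (fun m => integrable_circle (F m)) ?_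
  · have e1 : (fun m => circleCoeff f m * circleCoeff g (n - m)) =
        fun m => ∫ t, F m t ∂AddCircle.haarAddCircle := by
      funext m
      simp only [F, ContinuousMap.smul_apply, ContinuousMap.mul_apply, smul_eq_mul,
        integral_const_mul]
      rfl
    have e2 : circleCoeff (f * g) n = ∫ t, ∑' m, F m t ∂AddCircle.haarAddCircle := by
      unfold circleCoeff fourierCoeff
      refine integral_congr_ae (Eventually.of_forall fun t => ?_)
      have ht := ((hasSum_circleCoeff hf t).mul_right (fourier (-n) t * (g t : ℂ))).tsum_eq
      simp only [hF, ht, ContinuousMap.mul_apply, smul_eq_mul, Complex.ofReal_mul]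
      ring
    rw [e1, e2]
    exact h
  · refine (hf.mul_right ‖g‖).of_nonneg_of_le
      (fun m => integral_nonneg fun t => norm_nonneg _) fun m => ?_
    have := norm_integral_le_of_norm_le_const (μ := AddCircle.haarAddCircle (T := (1 : ℝ)))
      (f := fun t : UnitAddCircle => ‖F m t‖) (C := ‖circleCoeff f m‖ * ‖g‖)
      (Eventually.of_forall fun t => by
        rw [norm_norm, hF, norm_mul, norm_mul, norm_mul, norm_fourier_apply, norm_fourier_apply,
          mul_one, one_mul, Complex.norm_real]
        gcongr
        exact g.norm_coe_le_norm t)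
    refine (le_abs_self _).trans ?_
    simpa using this

theorem sobolevWeight_le {r : ℝ} (hr : 0 ≤ r) (m k : ℝ) :
    (1 + (m + k) ^ 2) ^ (r / 2) ≤
      4 ^ (r / 2) * ((1 + m ^ 2) ^ (r / 2) + (1 + k ^ 2) ^ (r / 2)) := by
  wlog h : m ^ 2 ≤ k ^ 2 generalizing m k
  · have := this k m (le_of_not_ge h)
    rwa [add_comm k m, add_comm ((1 + k ^ 2) ^ (r / 2))] at this
  calc (1 + (m + k) ^ 2) ^ (r / 2) ≤ (4 * (1 + k ^ 2)) ^ (r / 2) := by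
        gcongr
        nlinarith [sq_nonneg (m - k)]
    _ = 4 ^ (r / 2) * (1 + k ^ 2) ^ (r / 2) := Real.mul_rpow (by norm_num) (by positivity)
    _ ≤ _ := by
        gcongr
        have : 0 ≤ (1 + m ^ 2) ^ (r / 2) := by positivity
        linarith

/-- The weight at n is bounded by the sum of the weights at m and n - m. Each resulting convolution
has one weighted ℓ² factor and one unweighted ℓ¹ factor. -/
theorem mul_mem_sobolevSubmodule {r : ℝ} (hr : 1 / 2 < r) {f g : C(UnitAddCircle, ℝ)}
    (hf : f ∈ sobolevSubmodule r) (hg : g ∈ sobolevSubmodule r) : f * g ∈ sobolevSubmodule r := by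
  have hf1 := summable_norm_circleCoeff hr hf
  have hg1 := summable_norm_circleCoeff hr hg
  have hf2 := mem_sobolevSubmodule_iff.mp hf
  have hg2 := mem_sobolevSubmodule_iff.mp hg
  simp only [← norm_weightedCoeff_sq] at hf2 hg2
  have hw : ∀ (h : C(UnitAddCircle, ℝ)) (n : ℤ),
      ‖weightedCoeff r h n‖ = (1 + (n : ℝ) ^ 2) ^ (r / 2) * ‖circleCoeff h n‖ := fun h n => by
    rw [weightedCoeff, norm_smul, Real.norm_of_nonneg (by positivity)]
  obtain ⟨s1, S1⟩ := summable_sq_convolution (a := fun n => ‖weightedCoeff r g n‖)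
    (b := fun n => ‖circleCoeff f n‖) (fun _ => norm_nonneg _) (fun _ => norm_nonneg _) hg2 hf1
  obtain ⟨s2, S2⟩ := summable_sq_convolution (a := fun n => ‖weightedCoeff r f n‖)
    (b := fun n => ‖circleCoeff g n‖) (fun _ => norm_nonneg _) (fun _ => norm_nonneg _) hf2 hg1
  rw [mem_sobolevSubmodule_iff]
  simp only [← norm_weightedCoeff_sq]
  refine (((S1.add S2).mul_left ((4 ^ (r / 2)) ^ 2 * 2))).of_nonneg_of_le
    (fun n => sq_nonneg _) fun n => ?_
  have s2' : Summable fun m => ‖circleCoeff g (n - m)‖ * ‖weightedCoeff r f m‖ := by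
    simpa [Function.comp_def] using ((Equiv.subLeft n).summable_iff).mpr (s2 n)
  have e2 : ∑' m, ‖circleCoeff g (n - m)‖ * ‖weightedCoeff r f m‖ =
      ∑' m, ‖circleCoeff g m‖ * ‖weightedCoeff r f (n - m)‖ := by
    simpa using (Equiv.subLeft n).tsum_eq fun m => ‖circleCoeff g m‖ * ‖weightedCoeff r f (n - m)‖
  have hc := (hasSum_circleCoeff_mul (g := g) hf1 n).mul_left
    (((1 + (n : ℝ) ^ 2) ^ (r / 2) : ℝ) : ℂ)
  have hterm : ∀ m, ‖(((1 + (n : ℝ) ^ 2) ^ (r / 2) : ℝ) : ℂ) *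
      (circleCoeff f m * circleCoeff g (n - m))‖ ≤
      4 ^ (r / 2) * (‖circleCoeff f m‖ * ‖weightedCoeff r g (n - m)‖ +
        ‖circleCoeff g (n - m)‖ * ‖weightedCoeff r f m‖) := by
    intro m
    rw [norm_mul, norm_mul, Complex.norm_real, Real.norm_of_nonneg (by positivity), hw, hw]
    have h := sobolevWeight_le (r := r) (by linarith) (m : ℝ) ((n - m : ℤ) : ℝ)
    rw [show (m : ℝ) + ((n - m : ℤ) : ℝ) = n by push_cast; ring] at h
    refine (mul_le_mul_of_nonneg_right h (by positivity)).trans_eq ?_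
    ring
  have hbound := tsum_of_norm_bounded (((s1 n).add s2').mul_left (4 ^ (r / 2))).hasSum hterm
  rw [hc.tsum_eq, tsum_mul_left, (s1 n).tsum_add s2', e2] at hbound
  rw [norm_mul, Complex.norm_real, Real.norm_of_nonneg (by positivity), ← hw] at hbound
  refine (pow_le_pow_left₀ (norm_nonneg _) hbound 2).trans ?_
  rw [mul_pow, mul_assoc]
  gcongr
  exact add_sq_le

/-! ### Derivatives -/

/-- `g` is the derivative of `f` along the circle. -/
def HasCircleDeriv (f g : C(UnitAddCircle, ℝ)) : Prop :=
  ∀ x : ℝ, HasDerivAt (fun y : ℝ => f (y : UnitAddCircle)) (g (x : UnitAddCircle)) x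

theorem circleCoeff_eq_integral (f : C(UnitAddCircle, ℝ)) (n : ℤ) :
    circleCoeff f n = ∫ x in (0 : ℝ)..1,
      fourier (-n) (x : UnitAddCircle) * (f (x : UnitAddCircle) : ℂ) := by
  unfold circleCoeff
  rw [fourierCoeff_eq_intervalIntegral _ n 0]
  simp

theorem HasCircleDeriv.circleCoeff_eq {f g : C(UnitAddCircle, ℝ)} (h : HasCircleDeriv f g)
    (n : ℤ) : circleCoeff g n = 2 * Real.pi * Complex.I * n * circleCoeff f n := by
  rw [circleCoeff_eq_integral, circleCoeff_eq_integral]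
  have hc : ∀ k : C(UnitAddCircle, ℝ), Continuous fun x : ℝ =>
      fourier (-n) (x : UnitAddCircle) * (k (x : UnitAddCircle) : ℂ) := fun k =>
    ((fourier (-n)).continuous.comp (AddCircle.continuous_mk' 1)).mul
      (Complex.continuous_ofReal.comp (k.continuous.comp (AddCircle.continuous_mk' 1)))
  have hd : ∀ x : ℝ, HasDerivAt
      (fun x : ℝ => fourier (-n) (x : UnitAddCircle) * (f (x : UnitAddCircle) : ℂ))
      (fourier (-n) (x : UnitAddCircle) * (g (x : UnitAddCircle) : ℂ) -
        2 * Real.pi * Complex.I * n *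
          (fourier (-n) (x : UnitAddCircle) * (f (x : UnitAddCircle) : ℂ))) x := by
    intro x
    refine ((hasDerivAt_fourier_neg 1 n x).mul (h x).ofReal_comp).congr_deriv ?_
    rw [Complex.ofReal_one, div_one]
    ring
  have hc' : Continuous fun x : ℝ => 2 * Real.pi * Complex.I * n *
      (fourier (-n) (x : UnitAddCircle) * (f (x : UnitAddCircle) : ℂ)) := continuous_const.mul (hc f)
  have hi := intervalIntegral.integral_eq_sub_of_hasDerivAt (a := 0) (b := 1)
    (fun x _ => hd x) (((hc g).sub hc').intervalIntegrable _ _)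
  rw [intervalIntegral.integral_sub ((hc g).intervalIntegrable _ _)
    (hc'.intervalIntegrable _ _),
    intervalIntegral.integral_const_mul] at hi
  have h1 : ((1 : ℝ) : UnitAddCircle) = ((0 : ℝ) : UnitAddCircle) := by
    simp
  rw [h1, sub_self] at hi
  exact sub_eq_zero.mp hi

theorem HasCircleDeriv.norm_circleCoeff_sq {f g : C(UnitAddCircle, ℝ)} (h : HasCircleDeriv f g)
    (n : ℤ) : ‖circleCoeff g n‖ ^ 2 = (2 * Real.pi) ^ 2 * ((n : ℝ) ^ 2 * ‖circleCoeff f n‖ ^ 2) := by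
  rw [h.circleCoeff_eq]
  simp only [norm_mul, Complex.norm_real, Complex.norm_I, Complex.norm_intCast, mul_pow,
    Real.norm_eq_abs, sq_abs]
  norm_num
  ring

theorem HasCircleDeriv.deriv_mem {f g : C(UnitAddCircle, ℝ)} (h : HasCircleDeriv f g) {r : ℝ}
    (hf : f ∈ sobolevSubmodule r) : g ∈ sobolevSubmodule (r - 1) := by
  rw [mem_sobolevSubmodule_iff] at hf ⊢
  refine (hf.mul_left ((2 * Real.pi) ^ 2)).of_nonneg_of_le (fun n => by positivity) fun n => ?_
  have hp : (0 : ℝ) < 1 + (n : ℝ) ^ 2 := by positivity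
  rw [h.norm_circleCoeff_sq, show (1 + (n : ℝ) ^ 2) ^ r = (1 + (n : ℝ) ^ 2) ^ (r - 1) *
    (1 + (n : ℝ) ^ 2) by rw [← Real.rpow_add_one hp.ne', sub_add_cancel]]
  have : (n : ℝ) ^ 2 ≤ 1 + (n : ℝ) ^ 2 := by linarith
  calc _ = (2 * Real.pi) ^ 2 * ((1 + (n : ℝ) ^ 2) ^ (r - 1) * (n : ℝ) ^ 2 *
        ‖circleCoeff f n‖ ^ 2) := by ring
    _ ≤ _ := by gcongr

/-- The derivative controls every mode except n = 0, and a single mode cannot affect summability. -/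
theorem HasCircleDeriv.mem {f g : C(UnitAddCircle, ℝ)} (h : HasCircleDeriv f g) {r : ℝ}
    (hg : g ∈ sobolevSubmodule r) : f ∈ sobolevSubmodule (r + 1) := by
  rw [mem_sobolevSubmodule_iff] at hg ⊢
  refine hg.of_norm_bounded_eventually ?_
  refine (Set.finite_singleton (0 : ℤ)).subset fun n hn => ?_
  by_contra h0
  refine hn ?_
  have hp : (0 : ℝ) < 1 + (n : ℝ) ^ 2 := by positivity
  have h1 : (1 : ℝ) ≤ (n : ℝ) ^ 2 := by
    have h0' : n ≠ 0 := h0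
    have : 0 < n ^ 2 := by positivity
    exact_mod_cast this
  change ‖(1 + (n : ℝ) ^ 2) ^ (r + 1) * ‖circleCoeff f n‖ ^ 2‖ ≤
    (1 + (n : ℝ) ^ 2) ^ r * ‖circleCoeff g n‖ ^ 2
  rw [Real.norm_of_nonneg (by positivity), h.norm_circleCoeff_sq, Real.rpow_add_one hp.ne',
    mul_assoc]
  have h2 : 1 + (n : ℝ) ^ 2 ≤ (2 * Real.pi) ^ 2 * (n : ℝ) ^ 2 := by
    have h3 : 1 ≤ Real.pi ^ 2 := by nlinarith [Real.pi_gt_three]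
    nlinarith [mul_le_mul_of_nonneg_right h3 (sq_nonneg (n : ℝ))]
  have := mul_le_mul_of_nonneg_right h2 (sq_nonneg ‖circleCoeff f n‖)
  rw [mul_assoc] at this
  gcongr

/-- Termwise differentiation of the Fourier series, once ∑ |n| |f̂(n)| is known to converge. -/
theorem exists_hasCircleDeriv {r : ℝ} (hr : 3 / 2 < r) {f : C(UnitAddCircle, ℝ)}
    (hf : f ∈ sobolevSubmodule r) : ∃ g, HasCircleDeriv f g := by
  have hs := summable_norm_circleCoeff (by linarith) hf
  have hs' : Summable fun n : ℤ => 2 * Real.pi * (|(n : ℝ)| * ‖circleCoeff f n‖) := by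
    refine Summable.mul_left _ (((summable_sobolevWeight (r := r - 1) (by linarith)).add
      (mem_sobolevSubmodule_iff.mp hf)).of_nonneg_of_le (fun n => by positivity) fun n => ?_)
    have hp : (0 : ℝ) < 1 + (n : ℝ) ^ 2 := by positivity
    -- Weight for xy ≤ x² + y² with x = A, y = A⁻¹|n||f̂(n)|: x² is summable because r - 1 > 1/2,
    -- and y² is at most the Sobolev term.
    set A := (1 + (n : ℝ) ^ 2) ^ (-(r - 1) / 2) with hA
    have hA0 : 0 < A := by positivity
    have e1 : (1 + (n : ℝ) ^ 2) ^ (-(r - 1)) = A ^ 2 := (sobolevWeight_mul_self (r - 1) n).symm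
    have e2 : (1 + (n : ℝ) ^ 2) ^ r = A⁻¹ ^ 2 * (1 + (n : ℝ) ^ 2) := by
      rw [inv_pow, ← e1, ← Real.rpow_neg hp.le, ← Real.rpow_add_one hp.ne']
      congr 1
      ring
    rw [e1, e2]
    have e3 : |(n : ℝ)| * ‖circleCoeff f n‖ = A * (A⁻¹ * (|(n : ℝ)| * ‖circleCoeff f n‖)) := by
      field_simp
    have e4 : (A⁻¹ * (|(n : ℝ)| * ‖circleCoeff f n‖)) ^ 2 ≤
        A⁻¹ ^ 2 * (1 + (n : ℝ) ^ 2) * ‖circleCoeff f n‖ ^ 2 := by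
      rw [mul_pow, mul_pow, sq_abs, mul_assoc]
      gcongr
      linarith
    rw [e3]
    nlinarith [sq_nonneg (A - A⁻¹ * (|(n : ℝ)| * ‖circleCoeff f n‖)),
      sq_nonneg (A⁻¹ * (|(n : ℝ)| * ‖circleCoeff f n‖))]
  have hb : ∀ (n : ℤ) (x : UnitAddCircle),
      ‖circleCoeff f n * (2 * Real.pi * Complex.I * n * fourier n x)‖ ≤
        2 * Real.pi * (|(n : ℝ)| * ‖circleCoeff f n‖) := by
    intro n x
    simp only [norm_mul, norm_fourier_apply, Complex.norm_real, Complex.norm_I,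
      Complex.norm_intCast, Real.norm_of_nonneg Real.pi_pos.le]
    norm_num
    exact le_of_eq (by ring)
  let G : C(UnitAddCircle, ℂ) :=
    ⟨fun x => ∑' n, circleCoeff f n * (2 * Real.pi * Complex.I * n * fourier n x),
      continuous_tsum (fun n => by fun_prop) hs' hb⟩
  refine ⟨⟨fun x => (G x).re, by fun_prop⟩, fun x => ?_⟩
  have hd := hasDerivAt_tsum (𝕜 := ℝ) (F := ℂ) hs'
    (g := fun n (y : ℝ) => circleCoeff f n * fourier n (y : UnitAddCircle))
    (g' := fun n (y : ℝ) => circleCoeff f n *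
      (2 * Real.pi * Complex.I * n * fourier n (y : UnitAddCircle)))
    (fun n y => by
      have := (hasDerivAt_fourier 1 n y).const_mul (circleCoeff f n)
      simpa using this)
    (fun n y => hb n y) (y₀ := 0) (hasSum_circleCoeff hs _).summable x
  have hd' : HasDerivAt (fun y : ℝ => (f (y : UnitAddCircle) : ℂ)) (G x) x :=
    hd.congr_deriv rfl |>.congr_of_eventuallyEq
      (Eventually.of_forall fun y => (hasSum_circleCoeff hs _).tsum_eq.symm)
  exact Complex.reCLM.hasFDerivAt.comp_hasDerivAt x hd'

/-- `H^r(S¹)` is closed under inversion of positive functions. -/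
theorem inv_mem_sobolevSubmodule {r : ℝ} (hr : 3 / 2 < r) {f h : C(UnitAddCircle, ℝ)}
    (hf : f ∈ sobolevSubmodule r) (hfh : ∀ x, f x * h x = 1) : h ∈ sobolevSubmodule r := by
  obtain ⟨g, hg⟩ := exists_hasCircleDeriv hr hf
  have hgm := hg.deriv_mem hf
  have hf0 : ∀ x, f x ≠ 0 := fun x h0 => by simpa [h0] using hfh x
  have hinv : ∀ x, h x = (f x)⁻¹ := fun x => eq_inv_of_mul_eq_one_right (hfh x)
  -- h' = -f' h² expresses the derivative of h through h itself, which permits a bootstrap.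
  have hd : HasCircleDeriv h (-g * (h * h)) := by
    intro x
    have : HasDerivAt (fun y : ℝ => (f (y : UnitAddCircle))⁻¹) _ x := (hg x).inv (hf0 x)
    simp only [ContinuousMap.mul_apply, ContinuousMap.neg_apply, hinv]
    refine this.congr_deriv ?_
    have := hf0 x
    field_simp
  -- Each use of h' = -f' h² gains one order, up to the ceiling r set by f' ∈ H^{r-1}.
  have key : ∀ k : ℕ, h ∈ sobolevSubmodule (min ((k : ℝ) + 1) r) := by
    intro k
    induction k with
    | zero =>
      refine sobolevSubmodule_anti ?_ (hd.mem (mem_sobolevSubmodule_zero _))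
      simp
    | succ k ih =>
      have h1 : (1 : ℝ) / 2 < min ((k : ℝ) + 1) (r - 1) :=
        lt_min (by have : (0 : ℝ) ≤ k := k.cast_nonneg
                   linarith) (by linarith)
      have h2 : h ∈ sobolevSubmodule (min ((k : ℝ) + 1) (r - 1)) :=
        sobolevSubmodule_anti (min_le_min_left _ (by linarith)) ih
      have h3 : -g ∈ sobolevSubmodule (min ((k : ℝ) + 1) (r - 1)) :=
        sobolevSubmodule_anti (min_le_right _ _) (neg_mem hgm)
      have h4 := hd.mem (mul_mem_sobolevSubmodule h1 h3 (mul_mem_sobolevSubmodule h1 h2 h2))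
      rw [← min_add_add_right, sub_add_cancel] at h4
      exact_mod_cast h4
  obtain ⟨k, hk⟩ := exists_nat_ge r
  have := key k
  rwa [min_eq_right (by linarith)] at this

/-! ### The Sobolev algebra and its operations -/

/-- The three thresholds: 1/2 for products, 3/2 for differentiation and inversion, 5/2 so that r - 1
still exceeds 3/2. The instances pass between them. -/
instance fact_one_half_lt (r : ℝ) [h : Fact (3 / 2 < r)] : Fact (1 / 2 < r) :=
  ⟨by linarith [h.out]⟩

instance fact_three_halves_lt (r : ℝ) [h : Fact (5 / 2 < r)] : Fact (3 / 2 < r) :=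
  ⟨by linarith [h.out]⟩

instance fact_one_half_lt_sub (r : ℝ) [h : Fact (3 / 2 < r)] : Fact (1 / 2 < r - 1) :=
  ⟨by linarith [h.out]⟩

instance fact_three_halves_lt_sub (r : ℝ) [h : Fact (5 / 2 < r)] : Fact (3 / 2 < r - 1) :=
  ⟨by linarith [h.out]⟩

instance (r : ℝ) [h : Fact (1 / 2 < r)] : CompleteSpace (SobolevH r) :=
  SobolevH.completeSpace h.out

namespace SobolevH

variable {r : ℝ}

theorem per_add (f g : SobolevH r) (x : ℝ) : (f + g).per x = f.per x + g.per x := rfl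

theorem per_sub (f g : SobolevH r) (x : ℝ) : (f - g).per x = f.per x - g.per x := rfl

theorem per_neg (f : SobolevH r) (x : ℝ) : (-f).per x = -f.per x := rfl

theorem per_smul (c : ℝ) (f : SobolevH r) (x : ℝ) : (c • f).per x = c * f.per x := rfl

theorem per_zero (x : ℝ) : (0 : SobolevH r).per x = 0 := rfl

theorem continuous_per (f : SobolevH r) : Continuous f.per :=
  f.1.continuous.comp (AddCircle.continuous_mk' 1)

theorem per_add_one (f : SobolevH r) (x : ℝ) : f.per (x + 1) = f.per x := by
  unfold per
  rw [AddCircle.coe_add, AddCircle.coe_period, add_zero]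

/-- The continuous circle map with a given `1`-periodic continuous lift. -/
def _root_.circleLift (F : ℝ → ℝ) (hF : Continuous F) (hp : Function.Periodic F 1) :
    C(UnitAddCircle, ℝ) :=
  ⟨hp.lift, (QuotientAddGroup.isQuotientMap_mk _).continuous_iff.mpr hF⟩

theorem _root_.zero_hasCircleDeriv_one : HasCircleDeriv 1 0 := fun x => by
  simpa using hasDerivAt_const x (1 : ℝ)

theorem _root_.one_mem_sobolevSubmodule (r : ℝ) : (1 : C(UnitAddCircle, ℝ)) ∈ sobolevSubmodule r := by
  simpa using zero_hasCircleDeriv_one.mem (zero_mem (sobolevSubmodule (r - 1)))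

instance : One (SobolevH r) := ⟨of 1 (one_mem_sobolevSubmodule r)⟩

theorem per_one (x : ℝ) : (1 : SobolevH r).per x = 1 := rfl

instance [h : Fact (1 / 2 < r)] : Mul (SobolevH r) :=
  ⟨fun f g => of (f.1 * g.1) (mul_mem_sobolevSubmodule h.out f.2 g.2)⟩

theorem per_mul [Fact (1 / 2 < r)] (f g : SobolevH r) (x : ℝ) :
    (f * g).per x = f.per x * g.per x := rfl

/-- Evaluation at a point. -/
def evalL (r : ℝ) [h : Fact (1 / 2 < r)] (x : ℝ) : SobolevH r →L[ℝ] ℝ :=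
  (ContinuousMap.evalCLM ℝ (x : UnitAddCircle)).comp (sobolevToContinuousMap h.out)

theorem evalL_apply [Fact (1 / 2 < r)] (x : ℝ) (f : SobolevH r) : evalL r x f = f.per x := rfl

theorem tendsto_per [Fact (1 / 2 < r)] {u : ℕ → SobolevH r} {f : SobolevH r}
    (h : Tendsto u atTop (𝓝 f)) (x : ℝ) : Tendsto (fun n => (u n).per x) atTop (𝓝 (f.per x)) :=
  ((evalL r x).continuous.tendsto f).comp h

/-- Multiplication by a fixed element. -/
def mulLeftL [Fact (1 / 2 < r)] (f : SobolevH r) : SobolevH r →L[ℝ] SobolevH r :=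
  let T : SobolevH r →ₗ[ℝ] SobolevH r :=
    { toFun := fun g => f * g
      map_add' := fun g h => per_injective fun x => by simp only [per_mul, per_add]; ring
      map_smul' := fun c g => per_injective fun x => by
        simp only [per_mul, per_smul, RingHom.id_apply]; ring }
  -- Closed graph theorem: point evaluations are continuous and separate elements, so no norm
  -- estimate is needed.
  ContinuousLinearMap.ofSeqClosedGraph (g := T) fun _ g _ hu hy =>
    per_injective fun x =>
      tendsto_nhds_unique (tendsto_per hy x) ((tendsto_per hu x).const_mul (f.per x))

theorem mulLeftL_apply [Fact (1 / 2 < r)] (f g : SobolevH r) : mulLeftL f g = f * g := rfl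

/-- Multiplication as a continuous bilinear map. -/
def mulL (r : ℝ) [Fact (1 / 2 < r)] : SobolevH r →L[ℝ] SobolevH r →L[ℝ] SobolevH r :=
  let T : SobolevH r →ₗ[ℝ] SobolevH r →L[ℝ] SobolevH r :=
    { toFun := mulLeftL
      map_add' := fun f g => by
        ext1 h
        refine per_injective fun x => ?_
        simp only [add_apply, mulLeftL_apply, per_mul, per_add]
        ring
      map_smul' := fun c f => by
        ext1 h
        refine per_injective fun x => ?_
        simp only [smul_apply, mulLeftL_apply, per_mul, per_smul,
          RingHom.id_apply]
        ring }
  ContinuousLinearMap.ofSeqClosedGraph (g := T) fun u f y hu hy => by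
    ext1 g
    refine per_injective fun x => ?_
    have h1 : Tendsto (fun n => mulLeftL (u n) g) atTop (𝓝 (y g)) :=
      ((ContinuousLinearMap.apply ℝ (SobolevH r) g).continuous.tendsto y).comp hy
    exact tendsto_nhds_unique (tendsto_per h1 x) ((tendsto_per hu x).mul_const (g.per x))

/-- The mean value `∫_{S¹} f dx`. -/
def mean (r : ℝ) [Fact (1 / 2 < r)] : SobolevH r →L[ℝ] ℝ :=
  LinearMap.mkContinuous
    { toFun := fun f => ∫ x in (0 : ℝ)..1, f.per x
      map_add' := fun f g => intervalIntegral.integral_add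
        (f.continuous_per.intervalIntegrable _ _) (g.continuous_per.intervalIntegrable _ _)
      map_smul' := fun c f => intervalIntegral.integral_const_mul c f.per }
    (√(∑' n : ℤ, (1 + (n : ℝ) ^ 2) ^ (-r))) fun f => by
      refine (intervalIntegral.norm_integral_le_of_norm_le_const (C := ‖f.1‖)
        fun x _ => f.1.norm_coe_le_norm _).trans ?_
      simpa using norm_toContinuousMap_le Fact.out f

theorem mean_apply [Fact (1 / 2 < r)] (f : SobolevH r) :
    mean r f = ∫ x in (0 : ℝ)..1, f.per x := rfl

theorem mean_one [Fact (1 / 2 < r)] : mean r 1 = 1 := by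
  simp [mean_apply, per_one]

theorem exists_deriv [h : Fact (3 / 2 < r)] (f : SobolevH r) :
    ∃ g : SobolevH (r - 1), HasCircleDeriv f.1 g.1 := by
  obtain ⟨g, hg⟩ := exists_hasCircleDeriv h.out f.2
  exact ⟨of g (hg.deriv_mem f.2), hg⟩

theorem eq_of_hasDerivAt {a : ℝ} {f : SobolevH r} {g h : SobolevH a}
    (hg : ∀ x, HasDerivAt f.per (g.per x) x) (hh : ∀ x, HasDerivAt f.per (h.per x) x) : g = h :=
  per_injective fun x => (hg x).unique (hh x)

/-- Differentiation `H^r(S¹) → H^{r-1}(S¹)`. -/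
def derivL (r : ℝ) [Fact (3 / 2 < r)] : SobolevH r →L[ℝ] SobolevH (r - 1) :=
  let T : SobolevH r →ₗ[ℝ] SobolevH (r - 1) :=
    { toFun := fun f => f.exists_deriv.choose
      map_add' := fun f g => eq_of_hasDerivAt (f := f + g) (f + g).exists_deriv.choose_spec
        fun x => (f.exists_deriv.choose_spec x).add (g.exists_deriv.choose_spec x)
      map_smul' := fun c f => eq_of_hasDerivAt (f := c • f) (c • f).exists_deriv.choose_spec
        fun x => (f.exists_deriv.choose_spec x).const_mul c }
  -- Here Fourier coefficients replace point evaluations: differentiation multiplies each of them by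
  -- a constant, so limits pass through.
  ContinuousLinearMap.ofSeqClosedGraph (g := T) fun u f y hu hy => by
    have hc : ∀ (a : ℝ) [Fact (1 / 2 < a)] (v : ℕ → SobolevH a) (w : SobolevH a) (n : ℤ),
        Tendsto v atTop (𝓝 w) →
        Tendsto (fun k => circleCoeff (v k).1 n) atTop (𝓝 (circleCoeff w.1 n)) :=
      fun a ha v w n h =>
        (((continuous_circleCoeff n).comp (sobolevToContinuousMap ha.out).continuous).tendsto w).comp h
    have hT : ∀ (g : SobolevH r) (n : ℤ),
        circleCoeff (T g).1 n = 2 * Real.pi * Complex.I * n * circleCoeff g.1 n :=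
      fun g n => g.exists_deriv.choose_spec.circleCoeff_eq n
    have h0 : y.1 - (T f).1 = 0 := by
      refine circleCoeff_injective fun n => ?_
      have h1 : circleCoeff y.1 n = circleCoeff (T f).1 n := by
        refine tendsto_nhds_unique (hc _ _ _ n hy) ?_
        simp only [Function.comp_apply, hT]
        exact (hc _ _ _ n hu).const_mul _
      have h2 := circleCoeff_add (y.1 - (T f).1) (T f).1 n
      rw [sub_add_cancel, h1] at h2
      exact left_eq_add.mp ((add_comm _ _).trans h2.symm).symm
    exact Subtype.ext (sub_eq_zero.mp h0)

theorem hasDerivAt_per [Fact (3 / 2 < r)] (f : SobolevH r) (x : ℝ) :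
    HasDerivAt f.per ((derivL r f).per x) x :=
  f.exists_deriv.choose_spec x

theorem deriv_per [Fact (3 / 2 < r)] (f : SobolevH r) (x : ℝ) :
    deriv f.per x = (derivL r f).per x :=
  (f.hasDerivAt_per x).deriv

theorem integral_derivL [Fact (3 / 2 < r)] (f : SobolevH r) (x : ℝ) :
    ∫ y in (0 : ℝ)..x, (derivL r f).per y = f.per x - f.per 0 :=
  intervalIntegral.integral_eq_sub_of_hasDerivAt (fun y _ => f.hasDerivAt_per y)
    ((derivL r f).continuous_per.intervalIntegrable _ _)

theorem mean_derivL [Fact (3 / 2 < r)] (f : SobolevH r) : mean (r - 1) (derivL r f) = 0 := by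
  rw [mean_apply, integral_derivL]
  have := f.per_add_one 0
  rw [zero_add] at this
  rw [this, sub_self]

/-- Subtracting the mean is exactly what makes x ↦ ∫₀ˣ periodic. -/
theorem exists_primitive [Fact (3 / 2 < r)] (h : SobolevH (r - 1)) :
    ∃ f : sobolevZero r, derivL r f.1 = h - mean (r - 1) h • 1 := by
  set k := h - mean (r - 1) h • 1 with hk
  have hk0 : ∫ x in (0 : ℝ)..1, k.per x = 0 := by
    rw [← mean_apply, hk, map_sub, map_smul, mean_one]
    simp
  let F : ℝ → ℝ := fun x => ∫ y in (0 : ℝ)..x, k.per y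
  have hF : ∀ x, HasDerivAt F (k.per x) x := fun x =>
    intervalIntegral.integral_hasDerivAt_right (k.continuous_per.intervalIntegrable _ _)
      (k.continuous_per.stronglyMeasurableAtFilter _ _) k.continuous_per.continuousAt
  have hp : Function.Periodic F 1 := by
    intro x
    have h1 : Function.Periodic k.per 1 := k.per_add_one
    have h2 := h1.intervalIntegral_add_eq x 0
    rw [zero_add, hk0] at h2
    simp only [F]
    rw [← intervalIntegral.integral_add_adjacent_intervals
      (k.continuous_per.intervalIntegrable 0 x) (k.continuous_per.intervalIntegrable x (x + 1)),
      h2, add_zero]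
  have hc : Continuous F := continuous_iff_continuousAt.mpr fun x => (hF x).continuousAt
  have hd : HasCircleDeriv (circleLift F hc hp) k.1 := hF
  have hm := hd.mem k.2
  rw [sub_add_cancel] at hm
  refine ⟨⟨of _ hm, intervalIntegral.integral_same⟩, ?_⟩
  exact eq_of_hasDerivAt (f := of _ hm) (hasDerivAt_per _) hF

/-- A primitive of `h - ∫_{S¹} h`. -/
def primitive [Fact (3 / 2 < r)] (h : SobolevH (r - 1)) : sobolevZero r :=
  h.exists_primitive.choose

theorem derivL_primitive [Fact (3 / 2 < r)] (h : SobolevH (r - 1)) :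
    derivL r h.primitive.1 = h - mean (r - 1) h • 1 :=
  h.exists_primitive.choose_spec

theorem _root_.sobolevZero_ext [Fact (3 / 2 < r)] {f g : sobolevZero r}
    (h : derivL r f.1 = derivL r g.1) : f = g := by
  apply Subtype.ext
  refine per_injective fun x => ?_
  have hf := f.1.integral_derivL x
  have hg := g.1.integral_derivL x
  have hf0 : f.1.per 0 = 0 := f.2
  have hg0 : g.1.per 0 = 0 := g.2
  rw [h, hg] at hf
  linarith

theorem _root_.isClosed_sobolevZero [Fact (1 / 2 < r)] :
    IsClosed (sobolevZero r : Set (SobolevH r)) :=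
  isClosed_singleton.preimage (evalL r 0).continuous

/-- The primitive `x ↦ ∫₀ˣ (h - ∫_{S¹} h) dy`. -/
def primL (r : ℝ) [Fact (3 / 2 < r)] : SobolevH (r - 1) →L[ℝ] sobolevZero r :=
  haveI : CompleteSpace (sobolevZero r) := isClosed_sobolevZero.completeSpace_coe
  let T : SobolevH (r - 1) →ₗ[ℝ] sobolevZero r :=
    { toFun := primitive
      map_add' := fun f g => sobolevZero_ext <| by
        rw [Submodule.coe_add, map_add, derivL_primitive, derivL_primitive,
          derivL_primitive, map_add, add_smul]
        abel
      map_smul' := fun c f => sobolevZero_ext <| by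
        rw [RingHom.id_apply, Submodule.coe_smul, map_smul, derivL_primitive,
          derivL_primitive, map_smul, smul_sub, smul_assoc] }
  ContinuousLinearMap.ofSeqClosedGraph (g := T) fun u f y hu hy => sobolevZero_ext <| by
    have hT : ∀ h, derivL r (T h).1 = h - mean (r - 1) h • 1 := derivL_primitive
    have h1 : Tendsto (fun n => derivL r (T (u n)).1) atTop (𝓝 (derivL r y.1)) :=
      (((derivL r).continuous.comp continuous_subtype_val).tendsto y).comp hy
    refine tendsto_nhds_unique h1 ?_
    simp only [hT]
    exact hu.sub ((((mean (r - 1)).continuous.tendsto f).comp hu).smul_const _)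

theorem derivL_primL [Fact (3 / 2 < r)] (h : SobolevH (r - 1)) :
    derivL r (primL r h).1 = h - mean (r - 1) h • 1 :=
  derivL_primitive h

/-! ### Inversion -/

/-- The multiplicative inverse of a nowhere vanishing function. -/
def inv [Fact (1 / 2 < r)] (f : SobolevH r) : SobolevH r := Ring.inverse (mulL r f) 1

theorem isUnit_mulL [hr : Fact (3 / 2 < r)] {f : SobolevH r} (hf : ∀ x, f.per x ≠ 0) :
    IsUnit (mulL r f) := by
  have hf' : ∀ x, f.1 x ≠ 0 := fun x => QuotientAddGroup.induction_on x hf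
  let h : C(UnitAddCircle, ℝ) := ⟨fun x => (f.1 x)⁻¹, f.1.continuous.inv₀ hf'⟩
  have hh : ∀ x, f.1 x * h x = 1 := fun x => mul_inv_cancel₀ (hf' x)
  have hm := inv_mem_sobolevSubmodule hr.out f.2 hh
  have hx : ∀ x, f.per x * (of h hm).per x = 1 := fun x => hh x
  refine ⟨⟨mulL r f, mulL r (of h hm), ?_, ?_⟩, rfl⟩
  · ext1 g
    refine per_injective fun x => ?_
    change f.per x * ((of h hm).per x * g.per x) = g.per x
    rw [← mul_assoc, hx, one_mul]
  · ext1 g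
    refine per_injective fun x => ?_
    change (of h hm).per x * (f.per x * g.per x) = g.per x
    rw [← mul_assoc, mul_comm (SobolevH.per _ x), hx, one_mul]

theorem per_inv [Fact (3 / 2 < r)] {f : SobolevH r} (hf : ∀ x, f.per x ≠ 0) (x : ℝ) :
    f.inv.per x = (f.per x)⁻¹ := by
  have h := Ring.mul_inverse_cancel _ (isUnit_mulL hf)
  have h1 : f * f.inv = 1 := congrArg (fun T : SobolevH r →L[ℝ] SobolevH r => T 1) h
  have h2 := congrArg (fun g => g.per x) h1
  simp only [per_mul, per_one] at h2
  exact eq_inv_of_mul_eq_one_right h2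

/-- Inversion factors as f ↦ `mulL r f`, then inversion in the Banach algebra of bounded operators,
smooth at units, then evaluation at 1. -/
theorem contDiffAt_inv [Fact (3 / 2 < r)] {f : SobolevH r} (hf : ∀ x, f.per x ≠ 0) :
    ContDiffAt ℝ ∞ (inv : SobolevH r → SobolevH r) f := by
  obtain ⟨u, hu⟩ := isUnit_mulL hf
  have h1 : ContDiffAt ℝ ∞ (Ring.inverse : (SobolevH r →L[ℝ] SobolevH r) → _) (mulL r f) := by
    rw [← hu]
    exact contDiffAt_ringInverse ℝ u
  exact (h1.comp f (mulL r).contDiff.contDiffAt).clm_apply contDiffAt_const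

theorem isOpen_setOf_per_pos [h : Fact (1 / 2 < r)] :
    IsOpen {f : SobolevH r | ∀ x, 0 < f.per x} := by
  have h1 : IsOpen {f : C(UnitAddCircle, ℝ) | MapsTo f univ (Ioi 0)} :=
    ContinuousMap.isOpen_setOfPred_mapsTo isCompact_univ isOpen_Ioi
  convert h1.preimage (sobolevToContinuousMap h.out).continuous using 1
  ext f
  exact ⟨fun hf x _ => QuotientAddGroup.induction_on x hf, fun hf x => hf (mem_univ _)⟩

end SobolevH

/-! ### Parallel tensors on an open subset of a normed space -/

section Geometry

variable {E : Type*} [NormedAddCommGroup E] [NormedSpace ℝ E] {K : Set E}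

theorem IsSmoothField.differentiableAt {X : E → E} (hX : IsSmoothField K X) (hK : IsOpen K) {p : E}
    (hp : p ∈ K) : DifferentiableAt ℝ X p :=
  (ContDiffOn.contDiffAt hX (hK.mem_nhds hp)).differentiableAt (by simp)

theorem IsSmoothField.apply {J : E → E →L[ℝ] E} (hJ : ContDiffOn ℝ ∞ J K) {X : E → E}
    (hX : IsSmoothField K X) : IsSmoothField K fun q => J q (X q) :=
  ContDiffOn.clm_apply hJ hX

/-- For constant coefficients the Leibniz rule accounts for the derivatives of Y and Z, leaving only
the Γ terms. -/
theorem isParallelForm_const (hK : IsOpen K) {Γ : E → E →L[ℝ] E →L[ℝ] E}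
    {Ω : E [⋀^Fin 2]→L[ℝ] ℝ} {B : E →L[ℝ] E →L[ℝ] ℝ} (hB : ∀ U V, Ω ![U, V] = B U V)
    (h : ∀ p ∈ K, ∀ X Y Z, B (Γ p Y X) Z + B Y (Γ p Z X) = 0) :
    IsParallelForm K Γ fun _ => Ω := by
  intro X Y Z _ hY hZ p hp
  simp only [hB]
  have hd := B.hasFDerivAt_of_bilinear (hY.differentiableAt hK hp).hasFDerivAt
    (hZ.differentiableAt hK hp).hasFDerivAt
  rw [hd.fderiv]
  have := h p hp (X p) (Y p) (Z p)
  simp only [covDeriv, map_sub, sub_apply, add_apply, ContinuousLinearMap.precompR_apply,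
    ContinuousLinearMap.precompL_apply, ContinuousLinearMap.compL_apply,
    ContinuousLinearMap.comp_apply]
  linarith

theorem isParallelTensor_of_fderiv (hK : IsOpen K) {Γ : E → E →L[ℝ] E →L[ℝ] E}
    {J : E → E →L[ℝ] E} (hJ : ContDiffOn ℝ ∞ J K)
    (h : ∀ p ∈ K, ∀ X Y, fderiv ℝ J p X Y = Γ p (J p Y) X - J p (Γ p Y X)) :
    IsParallelTensor K Γ J := by
  intro X Y _ hY p hp
  have hJp : DifferentiableAt ℝ J p := (hJ.contDiffAt (hK.mem_nhds hp)).differentiableAt (by simp)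
  have hd := hJp.hasFDerivAt.clm_apply (hY.differentiableAt hK hp).hasFDerivAt
  simp only [covDeriv]
  rw [hd.fderiv]
  simp only [add_apply, ContinuousLinearMap.comp_apply, ContinuousLinearMap.flip_apply, h p hp,
    map_sub]
  abel

theorem isMetricCompatible_of_isParallel {Γ : E → E →L[ℝ] E →L[ℝ] E}
    {g : E → E →L[ℝ] E →L[ℝ] ℝ} {Ω : E → E [⋀^Fin 2]→L[ℝ] ℝ} {J : E → E →L[ℝ] E}
    (hg : ∀ p U V, g p U V = Ω p ![J p U, V]) (hJ : ContDiffOn ℝ ∞ J K)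
    (hΩ : IsParallelForm K Γ Ω) (hJΓ : IsParallelTensor K Γ J) : IsMetricCompatible K Γ g := by
  intro X Y Z hX hY hZ p hp
  simp only [hg]
  rw [hΩ X (fun q => J q (Y q)) Z hX (hY.apply hJ) hZ p hp, hJΓ X Y hX hY p hp]

/-- Symmetry of Γ makes every bracket a difference of covariant derivatives. J then moves out of
each, and J² = I cancels the terms in pairs. -/
theorem nijenhuis_eq_zero_of_isParallelTensor {Γ : E → E →L[ℝ] E →L[ℝ] E} {J : E → E →L[ℝ] E}
    (hJ : ContDiffOn ℝ ∞ J K) (hJ2 : ∀ p ∈ K, ∀ U, J p (J p U) = U)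
    (hΓ : ∀ p ∈ K, ∀ U V, Γ p U V = Γ p V U) (hJΓ : IsParallelTensor K Γ J) {X Y : E → E}
    (hX : IsSmoothField K X) (hY : IsSmoothField K Y) {p : E} (hp : p ∈ K) :
    nijenhuis J X Y p = 0 := by
  have hb : ∀ V W : E → E, VectorField.lieBracket ℝ V W p = covDeriv Γ V W p - covDeriv Γ W V p := by
    intro V W
    simp only [VectorField.lieBracket, covDeriv, hΓ p hp (W p) (V p)]
    abel
  have hJX := hX.apply hJ
  have hJY := hY.apply hJ
  simp only [nijenhuis, hb, hJΓ X Y hX hY p hp, hJΓ Y X hY hX p hp, hJΓ _ Y hJX hY p hp,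
    hJΓ _ X hJY hX p hp, map_sub, hJ2 p hp]
  abel

end Geometry

/-- The continuous alternating map given by an alternating continuous bilinear form. -/
def alternatingOfBilinear {E : Type*} [NormedAddCommGroup E] [NormedSpace ℝ E]
    (B : E →L[ℝ] E →L[ℝ] ℝ) (hB : ∀ U, B U U = 0) : E [⋀^Fin 2]→L[ℝ] ℝ where
  toFun v := B (v 0) (v 1)
  map_update_add' := by
    intro _ v i x y
    fin_cases i <;> simp [Function.update]
  map_update_smul' := by
    intro _ v i c x
    fin_cases i <;> simp [Function.update]
  cont := by fun_prop
  map_eq_zero_of_eq' := by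
    intro v i j hv hij
    fin_cases i <;> fin_cases j <;> simp_all

/-! ### The tensors of `K^s` -/

open SobolevH

/-- The mean-zero representative of a class modulo constants. -/
def classLift (r : ℝ) [Fact (1 / 2 < r)] : SobolevH r ⧸ sobolevConst r →L[ℝ] SobolevH r :=
  (sobolevConst r).liftQL (.id ℝ _ - (mean r).smulRight 1) <| by
    rintro f ⟨c, hc⟩
    have hm : mean r f = c := by simp [mean_apply, hc]
    refine per_injective fun x => ?_
    change f.per x - mean r f * 1 = 0
    rw [hc, hm, mul_one, sub_self]

namespace KModel

variable {s : ℝ}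

theorem exists_eq_mk (U : KModel s) : ∃ U₁ U₂, U = mk U₁ U₂ := by
  obtain ⟨U₁, U₂⟩ := U
  obtain ⟨U₂, rfl⟩ := Submodule.Quotient.mk_surjective _ U₂
  exact ⟨U₁, U₂, rfl⟩

/-- The bilinear map `(U, V) ↦ L (B U V)`. -/
def postBilin {F : Type*} [NormedAddCommGroup F] [NormedSpace ℝ F]
    (L : SobolevH (s - 1) →L[ℝ] F) (B : KModel s →L[ℝ] KModel s →L[ℝ] SobolevH (s - 1)) :
    KModel s →L[ℝ] KModel s →L[ℝ] F :=
  (ContinuousLinearMap.compL ℝ (KModel s) (SobolevH (s - 1)) F L).comp B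

theorem _root_.ContDiffOn.postBilin {F : Type*} [NormedAddCommGroup F] [NormedSpace ℝ F]
    {K : Set (KModel s)} {L : KModel s → SobolevH (s - 1) →L[ℝ] F}
    {B : KModel s → KModel s →L[ℝ] KModel s →L[ℝ] SobolevH (s - 1)}
    (hL : ContDiffOn ℝ ∞ L K) (hB : ContDiffOn ℝ ∞ B K) :
    ContDiffOn ℝ ∞ (fun p => KModel.postBilin (L p) (B p)) K :=
  ((ContinuousLinearMap.contDiff _).comp_contDiffOn hL).clm_comp hB

variable [Fact (5 / 2 < s)]

/-- The derivative `U₁ₓ` of the first component. -/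
def derivFst (s : ℝ) [Fact (5 / 2 < s)] : KModel s →L[ℝ] SobolevH (s - 1) :=
  ((derivL s).comp (sobolevZero s).subtypeL).comp
    (ContinuousLinearMap.fst ℝ (sobolevZero s) (SobolevH (s - 1) ⧸ sobolevConst (s - 1)))

/-- The mean-zero representative of the second component. -/
def repSnd (s : ℝ) [Fact (5 / 2 < s)] : KModel s →L[ℝ] SobolevH (s - 1) :=
  (classLift (s - 1)).comp
    (ContinuousLinearMap.snd ℝ (sobolevZero s) (SobolevH (s - 1) ⧸ sobolevConst (s - 1)))

/-- The vector whose first component is the primitive of `h - ∫_{S¹} h`. -/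
def ofPrim (s : ℝ) [Fact (5 / 2 < s)] : SobolevH (s - 1) →L[ℝ] KModel s :=
  (ContinuousLinearMap.inl ℝ (sobolevZero s) (SobolevH (s - 1) ⧸ sobolevConst (s - 1))).comp
    (primL s)

/-- The vector whose second component is the class `[h]`. -/
def ofClass (s : ℝ) [Fact (5 / 2 < s)] : SobolevH (s - 1) →L[ℝ] KModel s :=
  (ContinuousLinearMap.inr ℝ (sobolevZero s) (SobolevH (s - 1) ⧸ sobolevConst (s - 1))).comp
    (sobolevConst (s - 1)).mkQL

theorem derivFst_eq (U : KModel s) : derivFst s U = derivL s U.1.1 := rfl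

theorem derivFst_mk (U₁ : sobolevZero s) (U₂ : SobolevH (s - 1)) :
    derivFst s (mk U₁ U₂) = derivL s U₁.1 := rfl

theorem repSnd_mk (U₁ : sobolevZero s) (U₂ : SobolevH (s - 1)) :
    repSnd s (mk U₁ U₂) = U₂ - mean (s - 1) U₂ • 1 := rfl

theorem derivFst_ofPrim (h : SobolevH (s - 1)) :
    derivFst s (ofPrim s h) = h - mean (s - 1) h • 1 := derivL_primL h

theorem derivFst_ofClass (h : SobolevH (s - 1)) : derivFst s (ofClass s h) = 0 :=
  map_zero (derivL s)

theorem repSnd_ofClass (h : SobolevH (s - 1)) :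
    repSnd s (ofClass s h) = h - mean (s - 1) h • 1 := rfl

theorem repSnd_ofPrim (h : SobolevH (s - 1)) : repSnd s (ofPrim s h) = 0 :=
  map_zero (classLift (s - 1))

theorem mean_derivFst (U : KModel s) : mean (s - 1) (derivFst s U) = 0 := mean_derivL _

theorem mean_repSnd (U : KModel s) : mean (s - 1) (repSnd s U) = 0 := by
  obtain ⟨U₁, U₂, rfl⟩ := U.exists_eq_mk
  rw [repSnd_mk, map_sub, map_smul, mean_one, smul_eq_mul, mul_one, sub_self]

/-- Second components are classes, so agreement up to a constant suffices; later comparisons can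
leave constants unspecified. -/
theorem ext_of_eq {U V : KModel s} (h₁ : derivFst s U = derivFst s V) (c : ℝ)
    (h₂ : repSnd s U = repSnd s V + c • 1) : U = V := by
  obtain ⟨U₁, U₂, rfl⟩ := U.exists_eq_mk
  obtain ⟨V₁, V₂, rfl⟩ := V.exists_eq_mk
  rw [repSnd_mk, repSnd_mk] at h₂
  obtain rfl : U₁ = V₁ := sobolevZero_ext h₁
  refine congrArg (Prod.mk U₁) ((Submodule.Quotient.eq _).mpr ?_)
  refine ⟨c + mean (s - 1) U₂ - mean (s - 1) V₂, fun x => ?_⟩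
  have := congrArg (fun f => f.per x) h₂
  simp only [per_sub, per_add, per_smul, per_one] at this ⊢
  linarith

/-! ### The base point and the tensor J. -/

/-- The derivative `φₓ`. -/
def phiDeriv (p : KModel s) : SobolevH (s - 1) := 1 + derivFst s p

theorem mean_phiDeriv (p : KModel s) : mean (s - 1) p.phiDeriv = 1 := by
  rw [phiDeriv, map_add, mean_one, mean_derivFst, add_zero]

theorem hasDerivAt_phi (p : KModel s) (x : ℝ) : HasDerivAt p.phi (p.phiDeriv.per x) x :=
  (hasDerivAt_id x).add (p.1.1.hasDerivAt_per x)

theorem deriv_phi (p : KModel s) (x : ℝ) : deriv p.phi x = p.phiDeriv.per x :=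
  (p.hasDerivAt_phi x).deriv

theorem mem_Kspace_iff {p : KModel s} : p ∈ Kspace s ↔ ∀ x, 0 < p.phiDeriv.per x := by
  simp only [← deriv_phi]
  rfl

theorem hasFDerivAt_phiDeriv (p : KModel s) :
    HasFDerivAt (phiDeriv : KModel s → _) (derivFst s) p :=
  (derivFst s).hasFDerivAt.const_add 1

theorem contDiff_phiDeriv : ContDiff ℝ ∞ (phiDeriv : KModel s → _) :=
  contDiff_const.add (derivFst s).contDiff

theorem isOpen_Kspace : IsOpen (Kspace s) := by
  have h := (isOpen_setOf_per_pos (r := s - 1)).preimage (contDiff_phiDeriv (s := s)).continuous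
  convert h using 1
  ext p
  exact mem_Kspace_iff

/-- The function `1 / φₓ`. -/
def phiDerivInv (p : KModel s) : SobolevH (s - 1) := p.phiDeriv.inv

theorem per_phiDerivInv {p : KModel s} (hp : p ∈ Kspace s) (x : ℝ) :
    p.phiDerivInv.per x = (p.phiDeriv.per x)⁻¹ :=
  per_inv (fun x => (mem_Kspace_iff.mp hp x).ne') x

theorem contDiffAt_phiDerivInv {p : KModel s} (hp : p ∈ Kspace s) :
    ContDiffAt ℝ ∞ (phiDerivInv : KModel s → _) p :=
  (contDiffAt_inv fun x => (mem_Kspace_iff.mp hp x).ne').comp p contDiff_phiDeriv.contDiffAt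

theorem contDiffOn_phiDerivInv : ContDiffOn ℝ ∞ (phiDerivInv : KModel s → _) (Kspace s) :=
  fun _ hp => (contDiffAt_phiDerivInv hp).contDiffWithinAt

/-- The representative of `[U₂]` with `∫ U₂ φₓ dx = 0`. -/
def rep (p : KModel s) : KModel s →L[ℝ] SobolevH (s - 1) :=
  repSnd s - (((mean (s - 1)).comp (mulL (s - 1) p.phiDeriv)).comp (repSnd s)).smulRight 1

theorem rep_apply (p U : KModel s) :
    p.rep U = repSnd s U - mean (s - 1) (p.phiDeriv * repSnd s U) • 1 := rfl

theorem contDiff_rep : ContDiff ℝ ∞ (rep : KModel s → _) :=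
  contDiff_const.sub (((contDiff_const.clm_comp ((mulL (s - 1)).contDiff.comp
    contDiff_phiDeriv)).clm_comp contDiff_const).smulRight contDiff_const)

/-- The vector with first component `∫₀ˣ h dy - φ(x) ∫_{S¹} h dy`. -/
def twistedPrim (p : KModel s) : SobolevH (s - 1) →L[ℝ] KModel s :=
  ofPrim s - (mean (s - 1)).smulRight (ofPrim s p.phiDeriv)

theorem contDiff_twistedPrim : ContDiff ℝ ∞ (twistedPrim : KModel s → _) :=
  contDiff_const.sub (contDiff_const.smulRight ((ofPrim s).contDiff.comp contDiff_phiDeriv))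

theorem derivFst_twistedPrim (p : KModel s) (h : SobolevH (s - 1)) :
    derivFst s (p.twistedPrim h) = h - mean (s - 1) h • p.phiDeriv := by
  change derivFst s (ofPrim s h - mean (s - 1) h • ofPrim s p.phiDeriv) = _
  rw [map_sub, map_smul, derivFst_ofPrim, derivFst_ofPrim, mean_phiDeriv, one_smul, smul_sub]
  abel

theorem repSnd_twistedPrim (p : KModel s) (h : SobolevH (s - 1)) :
    repSnd s (p.twistedPrim h) = 0 := by
  change repSnd s (ofPrim s h - mean (s - 1) h • ofPrim s p.phiDeriv) = _
  rw [map_sub, map_smul, repSnd_ofPrim, repSnd_ofPrim, smul_zero, sub_zero]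

/-- The tensor `J`. -/
def tensorJ (p : KModel s) : KModel s →L[ℝ] KModel s :=
  -(p.twistedPrim.comp ((mulL (s - 1) p.phiDeriv).comp (repSnd s))) -
    (ofClass s).comp ((mulL (s - 1) p.phiDerivInv).comp (derivFst s))

theorem contDiffOn_tensorJ : ContDiffOn ℝ ∞ (tensorJ : KModel s → _) (Kspace s) :=
  ((contDiff_twistedPrim.clm_comp (((mulL (s - 1)).contDiff.comp contDiff_phiDeriv).clm_comp
    contDiff_const)).neg.contDiffOn).sub
    (contDiffOn_const.clm_comp (((mulL (s - 1)).contDiff.comp_contDiffOn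
      contDiffOn_phiDerivInv).clm_comp contDiffOn_const))

theorem tensorJ_apply (p U : KModel s) :
    p.tensorJ U = -p.twistedPrim (p.phiDeriv * repSnd s U) -
      ofClass s (p.phiDerivInv * derivFst s U) := rfl

theorem derivFst_tensorJ' (p U : KModel s) : derivFst s (p.tensorJ U) =
    -(p.phiDeriv * repSnd s U - mean (s - 1) (p.phiDeriv * repSnd s U) • p.phiDeriv) := by
  rw [tensorJ_apply, map_sub, map_neg, derivFst_twistedPrim, derivFst_ofClass, sub_zero]

/-- One half of the swap (a, b) ↦ (-φₓ b, -a/φₓ); the other half is `rep_tensorJ`. -/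
theorem derivFst_tensorJ (p U : KModel s) :
    derivFst s (p.tensorJ U) = -(p.phiDeriv * p.rep U) := by
  rw [derivFst_tensorJ', rep_apply]
  refine per_injective fun x => ?_
  simp only [per_neg, per_sub, per_mul, per_smul, per_one]
  ring

theorem repSnd_tensorJ (p U : KModel s) : repSnd s (p.tensorJ U) =
    -(p.phiDerivInv * derivFst s U - mean (s - 1) (p.phiDerivInv * derivFst s U) • 1) := by
  rw [tensorJ_apply, map_sub, map_neg, repSnd_twistedPrim, repSnd_ofClass, neg_zero, zero_sub]

/-- Since φₓ has mean 1, the normalization ∫ U₂ φₓ = 0 absorbs any added constant. -/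
theorem rep_eq_of_repSnd_eq {p U : KModel s} {h : SobolevH (s - 1)} {c : ℝ}
    (hU : repSnd s U = h + c • 1) : p.rep U = h - mean (s - 1) (p.phiDeriv * h) • 1 := by
  have h1 : p.phiDeriv * repSnd s U = p.phiDeriv * h + c • p.phiDeriv := by
    refine per_injective fun x => ?_
    simp only [hU, per_add, per_mul, per_smul, per_one]
    ring
  rw [rep_apply, h1, map_add, map_smul, mean_phiDeriv, hU]
  refine per_injective fun x => ?_
  simp only [per_sub, per_add, per_smul, per_one, smul_eq_mul]
  ring

theorem phiDeriv_mul_phiDerivInv_mul {p : KModel s} (hp : p ∈ Kspace s) (h : SobolevH (s - 1)) :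
    p.phiDeriv * (p.phiDerivInv * h) = h := by
  refine per_injective fun x => ?_
  have := (mem_Kspace_iff.mp hp x).ne'
  simp only [per_mul, per_phiDerivInv hp]
  field_simp

theorem rep_tensorJ {p : KModel s} (hp : p ∈ Kspace s) (U : KModel s) :
    p.rep (p.tensorJ U) = -(p.phiDerivInv * derivFst s U) := by
  have h1 : repSnd s (p.tensorJ U) = -(p.phiDerivInv * derivFst s U) +
      mean (s - 1) (p.phiDerivInv * derivFst s U) • 1 := by
    rw [repSnd_tensorJ]
    abel
  rw [rep_eq_of_repSnd_eq h1]
  -- φₓ · (U₁ₓ/φₓ) = U₁ₓ has mean zero, so -U₁ₓ/φₓ is already normalized.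
  have h2 : p.phiDeriv * -(p.phiDerivInv * derivFst s U) = -derivFst s U := by
    rw [← phiDeriv_mul_phiDerivInv_mul hp (derivFst s U)]
    refine per_injective fun x => ?_
    have := (mem_Kspace_iff.mp hp x).ne'
    simp only [per_neg, per_mul, per_phiDerivInv hp]
    field_simp
  rw [h2, map_neg, mean_derivFst, neg_zero, zero_smul, sub_zero]

theorem ext_of_rep_eq (p : KModel s) {U V : KModel s} (h₁ : derivFst s U = derivFst s V)
    (h₂ : p.rep U = p.rep V) : U = V := by
  refine ext_of_eq h₁ (mean (s - 1) (p.phiDeriv * repSnd s U) -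
    mean (s - 1) (p.phiDeriv * repSnd s V)) ?_
  rw [rep_apply, rep_apply, sub_eq_iff_eq_add] at h₂
  rw [sub_smul]
  exact h₂.trans (by abel)

theorem tensorJ_tensorJ {p : KModel s} (hp : p ∈ Kspace s) (U : KModel s) :
    p.tensorJ (p.tensorJ U) = U := by
  refine ext_of_rep_eq p ?_ ?_
  · rw [derivFst_tensorJ, rep_tensorJ hp]
    refine per_injective fun x => ?_
    have := (mem_Kspace_iff.mp hp x).ne'
    simp only [per_neg, per_mul, per_phiDerivInv hp]
    field_simp
  · rw [rep_tensorJ hp, derivFst_tensorJ]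
    refine per_injective fun x => ?_
    have := (mem_Kspace_iff.mp hp x).ne'
    simp only [per_neg, per_mul, per_phiDerivInv hp]
    field_simp

/-! ### The Christoffel map. -/

/-- The bilinear map `(U, V) ↦ S U * T V`. -/
def mulBilin (S T : KModel s →L[ℝ] SobolevH (s - 1)) :
    KModel s →L[ℝ] KModel s →L[ℝ] SobolevH (s - 1) :=
  ((ContinuousLinearMap.compL ℝ (KModel s) (SobolevH (s - 1)) (SobolevH (s - 1))).flip T).comp
    ((mulL (s - 1)).comp S)

theorem _root_.ContDiff.mulBilin {S T : KModel s → KModel s →L[ℝ] SobolevH (s - 1)}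
    (hS : ContDiff ℝ ∞ S) (hT : ContDiff ℝ ∞ T) :
    ContDiff ℝ ∞ fun p => KModel.mulBilin (S p) (T p) :=
  ((ContinuousLinearMap.contDiff _).comp hT).clm_comp (contDiff_const.clm_comp hS)

/-- The function `(u₁ₓ v₁ₓ - π(u₂) π(v₂)) ∘ φ · φₓ`. -/
def density (p : KModel s) : KModel s →L[ℝ] KModel s →L[ℝ] SobolevH (s - 1) :=
  postBilin (mulL (s - 1) p.phiDerivInv) (mulBilin (derivFst s) (derivFst s)) -
    postBilin (mulL (s - 1) p.phiDeriv) (mulBilin p.rep p.rep)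

/-- The function `u₁ₓ π(v₂) + v₁ₓ π(u₂)`, composed with `φ` and multiplied by `φₓ`. -/
def crossTerm (p : KModel s) : KModel s →L[ℝ] KModel s →L[ℝ] SobolevH (s - 1) :=
  mulBilin (derivFst s) p.rep + mulBilin p.rep (derivFst s)

theorem per_density {p : KModel s} (hp : p ∈ Kspace s) (U V : KModel s) (x : ℝ) :
    (p.density U V).per x = (derivFst s U).per x * (derivFst s V).per x / p.phiDeriv.per x -
      (p.rep U).per x * (p.rep V).per x * p.phiDeriv.per x := by
  change p.phiDerivInv.per x * ((derivFst s U).per x * (derivFst s V).per x) -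
    p.phiDeriv.per x * ((p.rep U).per x * (p.rep V).per x) = _
  rw [per_phiDerivInv hp]
  field_simp

theorem per_crossTerm (p U V : KModel s) (x : ℝ) :
    (p.crossTerm U V).per x = (derivFst s U).per x * (p.rep V).per x +
      (p.rep U).per x * (derivFst s V).per x := rfl

theorem contDiffOn_density : ContDiffOn ℝ ∞ (density : KModel s → _) (Kspace s) :=
  (((mulL (s - 1)).contDiff.comp_contDiffOn contDiffOn_phiDerivInv).postBilin contDiffOn_const).sub
    (((mulL (s - 1)).contDiff.comp contDiff_phiDeriv).contDiffOn.postBilin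
      (contDiff_rep.mulBilin contDiff_rep).contDiffOn)

theorem contDiff_crossTerm : ContDiff ℝ ∞ (crossTerm : KModel s → _) :=
  (contDiff_const.mulBilin contDiff_rep).add (contDiff_rep.mulBilin contDiff_const)

/-- The Christoffel map `Γ`. -/
def christoffel (p : KModel s) : KModel s →L[ℝ] KModel s →L[ℝ] KModel s :=
  (1 / 2 : ℝ) • postBilin p.twistedPrim p.density -
    (1 / 2 : ℝ) • postBilin ((ofClass s).comp (mulL (s - 1) p.phiDerivInv)) p.crossTerm

theorem contDiffOn_christoffel : ContDiffOn ℝ ∞ (christoffel : KModel s → _) (Kspace s) :=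
  ((contDiff_twistedPrim.contDiffOn.postBilin contDiffOn_density).const_smul _).sub
    (((contDiffOn_const.clm_comp ((mulL (s - 1)).contDiff.comp_contDiffOn
      contDiffOn_phiDerivInv)).postBilin contDiff_crossTerm.contDiffOn).const_smul _)

theorem christoffel_apply (p U V : KModel s) :
    p.christoffel U V = (1 / 2 : ℝ) • p.twistedPrim (p.density U V) -
      (1 / 2 : ℝ) • ofClass s (p.phiDerivInv * p.crossTerm U V) := rfl

/-- Torsion-freeness of ∇, needed for the Nijenhuis tensor. -/
theorem christoffel_symm {p : KModel s} (hp : p ∈ Kspace s) (U V : KModel s) :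
    p.christoffel U V = p.christoffel V U := by
  have h1 : p.density U V = p.density V U := per_injective fun x => by
    simp only [per_density hp]
    ring
  have h2 : p.crossTerm U V = p.crossTerm V U := per_injective fun x => by
    simp only [per_crossTerm]
    ring
  rw [christoffel_apply, christoffel_apply, h1, h2]

theorem derivFst_christoffel (p U V : KModel s) : derivFst s (p.christoffel U V) =
    (1 / 2 : ℝ) • (p.density U V - mean (s - 1) (p.density U V) • p.phiDeriv) := by
  rw [christoffel_apply, map_sub, map_smul, map_smul, derivFst_twistedPrim, derivFst_ofClass,
    smul_zero, sub_zero]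

theorem repSnd_christoffel (p U V : KModel s) : ∃ c : ℝ, repSnd s (p.christoffel U V) =
    -(1 / 2 : ℝ) • (p.phiDerivInv * p.crossTerm U V) + c • 1 := by
  refine ⟨1 / 2 * mean (s - 1) (p.phiDerivInv * p.crossTerm U V), ?_⟩
  rw [christoffel_apply, map_sub, map_smul, map_smul, repSnd_twistedPrim, repSnd_ofClass]
  refine per_injective fun x => ?_
  simp only [per_sub, per_add, per_smul, per_one, per_zero]
  ring

theorem rep_christoffel {p : KModel s} (hp : p ∈ Kspace s) (U V : KModel s) :
    p.rep (p.christoffel U V) = -(1 / 2 : ℝ) • (p.phiDerivInv * p.crossTerm U V -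
      mean (s - 1) (p.crossTerm U V) • 1) := by
  obtain ⟨c, hc⟩ := repSnd_christoffel p U V
  rw [rep_eq_of_repSnd_eq hc]
  have h : p.phiDeriv * (-(1 / 2 : ℝ) • (p.phiDerivInv * p.crossTerm U V)) =
      -(1 / 2 : ℝ) • p.crossTerm U V := by
    refine per_injective fun x => ?_
    have := (mem_Kspace_iff.mp hp x).ne'
    simp only [per_smul, per_mul, per_phiDerivInv hp]
    field_simp
  rw [h, map_smul, smul_sub, smul_assoc]

/-! ### The form ω and the metric g = ω(J·, ·). -/

/-- The bilinear form `ω`. -/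
def formBilin (s : ℝ) [Fact (5 / 2 < s)] : KModel s →L[ℝ] KModel s →L[ℝ] ℝ :=
  (1 / 4 : ℝ) • postBilin (mean (s - 1))
    (mulBilin (derivFst s) (repSnd s) - mulBilin (repSnd s) (derivFst s))

theorem formBilin_apply (U V : KModel s) : formBilin s U V =
    1 / 4 * mean (s - 1) (derivFst s U * repSnd s V - repSnd s U * derivFst s V) := rfl

/-- The normalization at p shifts representatives by constants, which integrate to zero against U₁ₓ
and V₁ₓ. Thus the constant form can be computed in the coordinates (a, b) of any base point. -/
theorem formBilin_eq (p U V : KModel s) : formBilin s U V =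
    1 / 4 * mean (s - 1) (derivFst s U * p.rep V - p.rep U * derivFst s V) := by
  have h : derivFst s U * p.rep V - p.rep U * derivFst s V =
      (derivFst s U * repSnd s V - repSnd s U * derivFst s V) -
        mean (s - 1) (p.phiDeriv * repSnd s V) • derivFst s U +
        mean (s - 1) (p.phiDeriv * repSnd s U) • derivFst s V := by
    refine per_injective fun x => ?_
    simp only [rep_apply, per_sub, per_add, per_mul, per_smul, per_one]
    ring
  rw [h, map_add, map_sub, map_smul, map_smul, mean_derivFst, mean_derivFst, smul_zero, smul_zero,
    sub_zero, add_zero, formBilin_apply]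

theorem formBilin_self (U : KModel s) : formBilin s U U = 0 := by
  have h : derivFst s U * repSnd s U - repSnd s U * derivFst s U = 0 := per_injective fun x => by
    simp only [per_sub, per_mul, per_zero]
    ring
  rw [formBilin_apply, h, map_zero, mul_zero]

theorem formBilin_neg (U V : KModel s) : formBilin s U V = -formBilin s V U := by
  have h := formBilin_self (U + V)
  simp only [map_add, add_apply, formBilin_self] at h
  linarith

/-- The two-form `ω`. -/
def form (s : ℝ) [Fact (5 / 2 < s)] : KModel s [⋀^Fin 2]→L[ℝ] ℝ :=
  alternatingOfBilinear (formBilin s) formBilin_self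

theorem form_apply (U V : KModel s) : form s ![U, V] = formBilin s U V := rfl

theorem eq_zero_of_mean_mul_self {r : ℝ} [Fact (1 / 2 < r)] {f : SobolevH r}
    (h : mean r (f * f) = 0) : f = 0 := by
  have hc : Continuous (f * f).per := (f * f).continuous_per
  have h0 : ∀ x ∈ Icc (0 : ℝ) 1, f.per x = 0 := by
    by_contra! hne
    obtain ⟨x, hx, hx0⟩ := hne
    have hpos : 0 < ∫ x in (0 : ℝ)..1, (f * f).per x :=
      intervalIntegral.integral_pos zero_lt_one hc.continuousOn
        (fun y _ => mul_self_nonneg (f.per y)) ⟨x, hx, mul_self_pos.mpr hx0⟩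
    exact hpos.ne' h
  refine per_injective fun x => ?_
  have hp : Function.Periodic f.per 1 := f.per_add_one
  obtain ⟨y, hy, hxy⟩ := hp.exists_mem_Ico₀ zero_lt_one x
  rw [hxy, h0 y (Ico_subset_Icc_self hy)]
  rfl

/-- Testing against the class of U₁ₓ and against the primitive of the mean-zero representative of
[U₂] produces the squared L² norms of both. -/
theorem formBilin_nondegenerate {U : KModel s} (h : ∀ V, formBilin s U V = 0) : U = 0 := by
  have h1 : derivFst s U = 0 := by
    refine eq_zero_of_mean_mul_self ?_
    have := h (ofClass s (derivFst s U))
    rw [formBilin_apply, repSnd_ofClass, derivFst_ofClass, mean_derivFst, zero_smul, sub_zero] at this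
    have e : repSnd s U * 0 = 0 := per_injective fun x => mul_zero _
    rw [e, sub_zero] at this
    linarith
  have h2 : repSnd s U = 0 := by
    refine eq_zero_of_mean_mul_self ?_
    have := h (ofPrim s (repSnd s U))
    rw [formBilin_apply, repSnd_ofPrim, derivFst_ofPrim, mean_repSnd, zero_smul, sub_zero] at this
    have e : derivFst s U * 0 = 0 := per_injective fun x => mul_zero _
    rw [e, zero_sub, map_neg] at this
    linarith
  refine ext_of_eq (c := 0) (by rw [h1, map_zero]) (by rw [h2, map_zero, zero_smul, add_zero])

/-- The metric `g`. -/
def metric (p : KModel s) : KModel s →L[ℝ] KModel s →L[ℝ] ℝ := (formBilin s).comp p.tensorJ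

theorem metric_apply (p U V : KModel s) : p.metric U V = formBilin s (p.tensorJ U) V := rfl

theorem metric_eq {p : KModel s} (hp : p ∈ Kspace s) (U V : KModel s) :
    p.metric U V = 1 / 4 * mean (s - 1) (p.density U V) := by
  rw [metric_apply, formBilin_eq p, derivFst_tensorJ, rep_tensorJ hp]
  congr 2
  refine per_injective fun x => ?_
  simp only [per_density hp, per_sub, per_mul, per_neg, per_phiDerivInv hp]
  ring

theorem metric_symm {p : KModel s} (hp : p ∈ Kspace s) (U V : KModel s) :
    p.metric U V = p.metric V U := by
  rw [metric_eq hp, metric_eq hp]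
  congr 2
  refine per_injective fun x => ?_
  simp only [per_density hp]
  ring

theorem isPseudoRiemannianMetric_metric :
    IsPseudoRiemannianMetric (Kspace s) (metric : KModel s → _) where
  smooth := contDiffOn_const.clm_comp contDiffOn_tensorJ
  symm := fun _ hp => metric_symm hp
  nondegenerate := fun p hp U h => by
    have h1 : p.tensorJ U = 0 := formBilin_nondegenerate (U := p.tensorJ U) h
    rw [← tensorJ_tensorJ hp U, h1, map_zero]

theorem isSymplecticForm_form : IsSymplecticForm (Kspace s) fun _ => form s where
  smooth := contDiffOn_const
  closed := fun p _ => by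
    rw [extDeriv, fderiv_fun_const]
    exact map_zero (ContinuousAlternatingMap.alternatizeUncurryFinCLM ℝ _ _)
  nondegenerate := fun _ _ _ h => formBilin_nondegenerate h

/-- The mean corrections in Γ contribute multiples of ∫ φₓ b and ∫ a, both zero. -/
theorem formBilin_christoffel {p : KModel s} (hp : p ∈ Kspace s) (X Y Z : KModel s) :
    formBilin s (p.christoffel Y X) Z = 1 / 8 * mean (s - 1)
      (p.density Y X * p.rep Z + p.phiDerivInv * p.crossTerm Y X * derivFst s Z) := by
  have h0 : mean (s - 1) (p.phiDeriv * p.rep Z) = 0 := by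
    have : p.phiDeriv * p.rep Z = p.phiDeriv * repSnd s Z -
        mean (s - 1) (p.phiDeriv * repSnd s Z) • p.phiDeriv := by
      refine per_injective fun x => ?_
      simp only [rep_apply, per_sub, per_mul, per_smul, per_one]
      ring
    rw [this, map_sub, map_smul, mean_phiDeriv, smul_eq_mul, mul_one, sub_self]
  rw [formBilin_eq p, derivFst_christoffel, rep_christoffel hp]
  have h : (1 / 2 : ℝ) • (p.density Y X - mean (s - 1) (p.density Y X) • p.phiDeriv) * p.rep Z -
      (-(1 / 2 : ℝ) • (p.phiDerivInv * p.crossTerm Y X - mean (s - 1) (p.crossTerm Y X) • 1)) *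
        derivFst s Z =
      (1 / 2 : ℝ) • (p.density Y X * p.rep Z + p.phiDerivInv * p.crossTerm Y X * derivFst s Z) -
        (1 / 2 * mean (s - 1) (p.density Y X)) • (p.phiDeriv * p.rep Z) -
        (1 / 2 * mean (s - 1) (p.crossTerm Y X)) • derivFst s Z := by
    refine per_injective fun x => ?_
    simp only [per_sub, per_add, per_mul, per_smul, per_one]
    ring
  rw [h, map_sub, map_sub, map_smul, map_smul, map_smul, h0, mean_derivFst]
  simp only [smul_eq_mul]
  ring

/-- With indices for the vectors, the integrand of `formBilin_christoffel` is (a_X a_Y b_Z + a_X b_Y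
a_Z + b_X a_Y a_Z)/φₓ - φₓ b_X b_Y b_Z, symmetric in Y and Z. -/
theorem formBilin_christoffel_add {p : KModel s} (hp : p ∈ Kspace s) (X Y Z : KModel s) :
    formBilin s (p.christoffel Y X) Z + formBilin s Y (p.christoffel Z X) = 0 := by
  rw [formBilin_neg Y, formBilin_christoffel hp, formBilin_christoffel hp, add_neg_eq_zero]
  congr 2
  refine per_injective fun x => ?_
  simp only [per_add, per_mul, per_density hp, per_crossTerm, per_phiDerivInv hp]
  ring

theorem isParallelForm_form : IsParallelForm (Kspace s) christoffel fun _ => form s :=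
  isParallelForm_const isOpen_Kspace form_apply fun _ hp => formBilin_christoffel_add hp

/-! ### The derivative of J and the identity ∇J = 0. -/

theorem per_fderiv_phiDerivInv {p : KModel s} (hp : p ∈ Kspace s) (X : KModel s) (x : ℝ) :
    (fderiv ℝ phiDerivInv p X).per x = -(derivFst s X).per x / p.phiDeriv.per x ^ 2 := by
  have h1 := (evalL (s - 1) x).hasFDerivAt.comp p
    ((contDiffAt_phiDerivInv hp).differentiableAt (by simp)).hasFDerivAt
  have h2 := (hasDerivAt_inv (mem_Kspace_iff.mp hp x).ne').comp_hasFDerivAt p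
    ((evalL (s - 1) x).hasFDerivAt.comp p p.hasFDerivAt_phiDeriv)
  have h3 := h1.unique (h2.congr_of_eventuallyEq ?_)
  · have := congrArg (fun L : KModel s →L[ℝ] ℝ => L X) h3
    simp [evalL_apply] at this
    rw [this]
    ring
  · filter_upwards [isOpen_Kspace.mem_nhds hp] with q hq
    exact per_phiDerivInv hq x

theorem hasFDerivAt_tensorJ_apply {p : KModel s} (hp : p ∈ Kspace s) (U : KModel s)
    (L : KModel s →L[ℝ] SobolevH (s - 1)) :
    HasFDerivAt (fun q => L (tensorJ q U))
      (L.comp ((ContinuousLinearMap.apply ℝ (KModel s) U).comp (fderiv ℝ tensorJ p))) p :=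
  L.hasFDerivAt.comp p ((ContinuousLinearMap.apply ℝ (KModel s) U).hasFDerivAt.comp p
    ((contDiffOn_tensorJ.contDiffAt (isOpen_Kspace.mem_nhds hp)).differentiableAt
      (by simp)).hasFDerivAt)

theorem derivFst_fderiv_tensorJ {p : KModel s} (hp : p ∈ Kspace s) (X U : KModel s) :
    derivFst s (fderiv ℝ tensorJ p X U) =
      -(derivFst s X * p.rep U - mean (s - 1) (derivFst s X * p.rep U) • p.phiDeriv) := by
  have h1 := hasFDerivAt_tensorJ_apply hp U (derivFst s)
  simp only [derivFst_tensorJ'] at h1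
  have ha := ((mulL (s - 1)).flip (repSnd s U)).hasFDerivAt.comp p p.hasFDerivAt_phiDeriv
  have hb := (mean (s - 1)).hasFDerivAt.comp p ha
  have h2 := (ha.sub (hb.smul p.hasFDerivAt_phiDeriv)).neg
  have h3 : derivFst s (fderiv ℝ tensorJ p X U) = -(derivFst s X * repSnd s U -
      (mean (s - 1) (p.phiDeriv * repSnd s U) • derivFst s X +
        mean (s - 1) (derivFst s X * repSnd s U) • p.phiDeriv)) :=
    congrArg (fun T : KModel s →L[ℝ] SobolevH (s - 1) => T X) (h1.unique h2)
  have h4 : derivFst s X * p.rep U = derivFst s X * repSnd s U -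
      mean (s - 1) (p.phiDeriv * repSnd s U) • derivFst s X := by
    refine per_injective fun x => ?_
    simp only [rep_apply, per_sub, per_mul, per_smul, per_one]
    ring
  rw [h3, h4, map_sub, map_smul, mean_derivFst, smul_zero, sub_zero]
  abel

theorem repSnd_fderiv_tensorJ {p : KModel s} (hp : p ∈ Kspace s) (X U : KModel s) :
    ∃ c : ℝ, repSnd s (fderiv ℝ tensorJ p X U) =
      -(fderiv ℝ phiDerivInv p X * derivFst s U) + c • 1 := by
  refine ⟨mean (s - 1) (fderiv ℝ phiDerivInv p X * derivFst s U), ?_⟩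
  have h1 := hasFDerivAt_tensorJ_apply hp U (repSnd s)
  simp only [repSnd_tensorJ] at h1
  have ha := ((mulL (s - 1)).flip (derivFst s U)).hasFDerivAt.comp p
    ((contDiffAt_phiDerivInv hp).differentiableAt (by simp)).hasFDerivAt
  have h2 := (ha.sub (((mean (s - 1)).hasFDerivAt.comp p ha).smul_const 1)).neg
  have h3 : repSnd s (fderiv ℝ tensorJ p X U) = -(fderiv ℝ phiDerivInv p X * derivFst s U -
      mean (s - 1) (fderiv ℝ phiDerivInv p X * derivFst s U) • 1) :=
    congrArg (fun T : KModel s →L[ℝ] SobolevH (s - 1) => T X) (h1.unique h2)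
  rw [h3]
  abel

theorem fderiv_tensorJ {p : KModel s} (hp : p ∈ Kspace s) (X Y : KModel s) :
    fderiv ℝ tensorJ p X Y =
      p.christoffel (p.tensorJ Y) X - p.tensorJ (p.christoffel Y X) := by
  obtain ⟨c₁, hc₁⟩ := repSnd_fderiv_tensorJ hp X Y
  obtain ⟨c₂, hc₂⟩ := repSnd_christoffel p (p.tensorJ Y) X
  -- The constant collects c₁ from DJ, c₂ from Γ(JY, X), the mean removed in J, and the mean of the
  -- density, whose φₓ factor cancels against 1/φₓ.
  refine ext_of_eq ?_ (c₁ - c₂ + mean (s - 1) (p.phiDerivInv * derivFst s (p.christoffel Y X)) +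
    -(1 / 2) * -mean (s - 1) (p.density Y X)) ?_
  · have h : p.density (p.tensorJ Y) X =
        p.crossTerm Y X - (2 : ℝ) • (derivFst s X * p.rep Y) := by
      refine per_injective fun x => ?_
      have := (mem_Kspace_iff.mp hp x).ne'
      simp only [per_density hp, derivFst_tensorJ, rep_tensorJ hp, per_sub, per_smul, per_neg,
        per_mul, per_phiDerivInv hp, per_crossTerm]
      field_simp
      ring
    rw [derivFst_fderiv_tensorJ hp, map_sub, derivFst_christoffel, derivFst_tensorJ,
      rep_christoffel hp, h, map_sub, map_smul]
    refine per_injective fun x => ?_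
    have := (mem_Kspace_iff.mp hp x).ne'
    simp only [per_sub, per_smul, per_neg, per_mul, per_one, per_phiDerivInv hp, smul_eq_mul]
    field_simp
    ring
  · rw [hc₁, map_sub, hc₂, repSnd_tensorJ]
    refine per_injective fun x => ?_
    have := (mem_Kspace_iff.mp hp x).ne'
    simp only [derivFst_christoffel, per_sub, per_add, per_smul, per_neg, per_mul, per_one,
      per_fderiv_phiDerivInv hp, per_phiDerivInv hp, per_crossTerm, per_density hp,
      derivFst_tensorJ, rep_tensorJ hp]
    field_simp
    ring

theorem isParallelTensor_tensorJ : IsParallelTensor (Kspace s) christoffel tensorJ :=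
  isParallelTensor_of_fderiv isOpen_Kspace contDiffOn_tensorJ fun _ hp => fderiv_tensorJ hp

end KModel

/-! ### Right translation by the inverse diffeomorphism -/

/-- The value w(0) left by the inner integral cancels between the two terms, so w need not have mean
zero. -/
theorem invA_deriv {w w' : ℝ → ℝ} (hw : ∀ x, HasDerivAt w (w' x) x) (hw' : Continuous w') (x : ℝ) :
    invA (deriv w) x = -(∫ y in (0 : ℝ)..x, w y) + x * ∫ y in (0 : ℝ)..1, w y := by
  have hd : deriv w = w' := funext fun y => (hw y).deriv
  have hc : Continuous w := continuous_iff_continuousAt.mpr fun y => (hw y).continuousAt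
  have h1 : ∀ y, ∫ z in (0 : ℝ)..y, w' z = w y - w 0 := fun y =>
    intervalIntegral.integral_eq_sub_of_hasDerivAt (fun z _ => hw z) (hw'.intervalIntegrable _ _)
  have h2 : ∀ y, ∫ z in (0 : ℝ)..y, (w z - w 0) = (∫ z in (0 : ℝ)..y, w z) - y * w 0 := fun y => by
    rw [intervalIntegral.integral_sub (hc.intervalIntegrable _ _) intervalIntegrable_const]
    simp
  simp only [invA, hd, h1, h2]
  ring

namespace KModel

variable {s : ℝ}

theorem continuous_phi (p : KModel s) : Continuous p.phi :=
  continuous_id.add p.1.1.continuous_per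

theorem phi_zero (p : KModel s) : p.phi 0 = 0 := by
  have h : p.1.1.per 0 = 0 := p.1.2
  simp [phi, h]

theorem phi_add_int (p : KModel s) (x : ℝ) (n : ℤ) : p.phi (x + n) = p.phi x + n := by
  have h : Function.Periodic p.1.1.per 1 := p.1.1.per_add_one
  have := h.int_mul n x
  rw [mul_one] at this
  simp only [phi, this]
  ring

theorem strictMono_phi {p : KModel s} (hp : p ∈ Kspace s) : StrictMono p.phi :=
  strictMono_of_deriv_pos hp

theorem phi_one (p : KModel s) : p.phi 1 = 1 := by
  simpa [phi_zero] using p.phi_add_int 0 1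

/-- φ fixes every integer, so the intermediate value theorem applies on each [⌊y⌋, ⌊y⌋ + 1]. -/
theorem surjective_phi (p : KModel s) : Function.Surjective p.phi := by
  intro y
  have h0 : p.phi (⌊y⌋ : ℤ) = ⌊y⌋ := by simpa [phi_zero] using p.phi_add_int 0 ⌊y⌋
  have h1 : p.phi ((⌊y⌋ + 1 : ℤ) : ℝ) = (⌊y⌋ + 1 : ℤ) := by
    simpa only [zero_add, phi_zero] using p.phi_add_int 0 (⌊y⌋ + 1)
  have hy : y ∈ Icc (p.phi (⌊y⌋ : ℤ)) (p.phi ((⌊y⌋ + 1 : ℤ) : ℝ)) := by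
    rw [h0, h1]
    push_cast
    exact ⟨Int.floor_le y, (Int.lt_floor_add_one y).le⟩
  obtain ⟨x, -, hx⟩ := intermediate_value_Icc (by push_cast; linarith) p.continuous_phi.continuousOn hy
  exact ⟨x, hx⟩

theorem invFun_phi {p : KModel s} (hp : p ∈ Kspace s) (x : ℝ) :
    Function.invFun p.phi (p.phi x) = x :=
  Function.leftInverse_invFun (strictMono_phi hp).injective x

theorem phi_invFun (p : KModel s) (y : ℝ) : p.phi (Function.invFun p.phi y) = y :=
  Function.rightInverse_invFun p.surjective_phi y

theorem continuous_invFun_phi {p : KModel s} (hp : p ∈ Kspace s) :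
    Continuous (Function.invFun p.phi) := by
  have h : Function.invFun p.phi =
      ((strictMono_phi hp).orderIsoOfSurjective _ p.surjective_phi).symm := by
    funext y
    rw [OrderIso.eq_symm_apply]
    exact p.phi_invFun y
  rw [h]
  exact OrderIso.continuous _

variable [Fact (5 / 2 < s)]

theorem hasDerivAt_invFun_phi {p : KModel s} (hp : p ∈ Kspace s) (y : ℝ) :
    HasDerivAt (Function.invFun p.phi) (p.phiDeriv.per (Function.invFun p.phi y))⁻¹ y :=
  (p.hasDerivAt_phi _).of_local_left_inverse (continuous_invFun_phi hp).continuousAt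
    (mem_Kspace_iff.mp hp _).ne' (Eventually.of_forall p.phi_invFun)

theorem hasDerivAt_compInv {r : ℝ} [Fact (3 / 2 < r)] {p : KModel s} (hp : p ∈ Kspace s)
    (f : SobolevH r) (y : ℝ) : HasDerivAt (compInv f.per p.phi)
      ((derivL r f).per (Function.invFun p.phi y) / p.phiDeriv.per (Function.invFun p.phi y)) y :=
  (f.hasDerivAt_per _).comp y (hasDerivAt_invFun_phi hp y)

theorem integral_compInv {p : KModel s} (hp : p ∈ Kspace s) (f : SobolevH (s - 1)) (x : ℝ) :
    ∫ y in (0 : ℝ)..p.phi x, compInv f.per p.phi y =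
      ∫ y in (0 : ℝ)..x, (p.phiDeriv * f).per y := by
  have h := intervalIntegral.integral_comp_mul_deriv (a := 0) (b := x)
    (fun y _ => p.hasDerivAt_phi y) p.phiDeriv.continuous_per.continuousOn
    (f.continuous_per.comp (continuous_invFun_phi hp))
  rw [phi_zero] at h
  refine h.symm.trans (intervalIntegral.integral_congr fun y _ => ?_)
  simp only [Function.comp_apply, invFun_phi hp, per_mul]
  ring

theorem integral_compInv_one {p : KModel s} (hp : p ∈ Kspace s) (f : SobolevH (s - 1)) :
    ∫ y in (0 : ℝ)..1, compInv f.per p.phi y = mean (s - 1) (p.phiDeriv * f) := by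
  have h := integral_compInv hp f 1
  rwa [phi_one] at h

theorem rep_mk (p : KModel s) (U₁ : sobolevZero s) (U₂ : SobolevH (s - 1)) :
    p.rep (mk U₁ U₂) = U₂ - mean (s - 1) (p.phiDeriv * U₂) • 1 := by
  refine rep_eq_of_repSnd_eq (c := -mean (s - 1) U₂) ?_
  rw [repSnd_mk, neg_smul]
  abel

/-- ∫ U₂ ∘ φ⁻¹ = ∫ U₂ φₓ, so π at the identity becomes the normalization `rep` at φ. -/
theorem meanFree_compInv {p : KModel s} (hp : p ∈ Kspace s) (U₁ : sobolevZero s)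
    (U₂ : SobolevH (s - 1)) (y : ℝ) : meanFree (compInv U₂.per p.phi) y =
      (p.rep (mk U₁ U₂)).per (Function.invFun p.phi y) := by
  rw [meanFree, integral_compInv_one hp, rep_mk, per_sub, per_smul, per_one, mul_one]
  rfl

theorem deriv_compInv {p : KModel s} (hp : p ∈ Kspace s) (U₁ : sobolevZero s)
    (U₂ : SobolevH (s - 1)) (y : ℝ) : deriv (compInv U₁.1.per p.phi) y =
      (derivFst s (mk U₁ U₂)).per (Function.invFun p.phi y) /
        p.phiDeriv.per (Function.invFun p.phi y) :=
  (hasDerivAt_compInv hp U₁.1 y).deriv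

theorem density_compInv {p : KModel s} (hp : p ∈ Kspace s) (U₁ V₁ : sobolevZero s)
    (U₂ V₂ : SobolevH (s - 1)) :
    (fun y => deriv (compInv U₁.1.per p.phi) y * deriv (compInv V₁.1.per p.phi) y -
      meanFree (compInv U₂.per p.phi) y * meanFree (compInv V₂.per p.phi) y) =
    compInv (p.phiDerivInv * p.density (mk U₁ U₂) (mk V₁ V₂)).per p.phi := by
  funext y
  rw [deriv_compInv hp U₁ U₂, deriv_compInv hp V₁ V₂, meanFree_compInv hp U₁ U₂,
    meanFree_compInv hp V₁ V₂]
  simp only [compInv, Function.comp_apply, per_mul, per_density hp, per_phiDerivInv hp]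
  have := (mem_Kspace_iff.mp hp (Function.invFun p.phi y)).ne'
  field_simp

theorem isKMetric_metric : IsKMetric s metric := by
  intro p hp U₁ V₁ U₂ V₂
  rw [metric_eq hp, metricId, density_compInv hp, integral_compInv_one hp,
    phiDeriv_mul_phiDerivInv_mul hp]

theorem per_fst (U : KModel s) (x : ℝ) :
    U.1.1.per x = ∫ y in (0 : ℝ)..x, (derivFst s U).per y := by
  have h : U.1.1.per 0 = 0 := U.1.2
  rw [derivFst_eq, integral_derivL, h, sub_zero]

theorem integral_phiDeriv (p : KModel s) (x : ℝ) :
    ∫ y in (0 : ℝ)..x, p.phiDeriv.per y = p.phi x := by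
  have h := intervalIntegral.integral_eq_sub_of_hasDerivAt (a := 0) (b := x)
    (fun y _ => p.hasDerivAt_phi y) (p.phiDeriv.continuous_per.intervalIntegrable _ _)
  rwa [phi_zero, sub_zero] at h

theorem mk_eq_snd {U : KModel s} {h : SobolevH (s - 1)} {c : ℝ}
    (hU : repSnd s U = h + c • 1) : Submodule.Quotient.mk h = U.2 := by
  obtain ⟨U₁, U₂, rfl⟩ := U.exists_eq_mk
  refine (Submodule.Quotient.eq _).mpr ⟨-c - mean (s - 1) U₂, fun x => ?_⟩
  have := congrArg (fun f => f.per x) hU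
  simp only [repSnd_mk, per_sub, per_add, per_smul, per_one] at this ⊢
  linarith

theorem isKChristoffel_christoffel : IsKChristoffel s christoffel := by
  intro p hp U₁ V₁ U₂ V₂
  refine ⟨fun x => ?_, ?_⟩
  · set d := p.density (mk U₁ U₂) (mk V₁ V₂) with hd
    have hc : Continuous fun y => (derivL (s - 1) (p.phiDerivInv * d)).per
        (Function.invFun p.phi y) / p.phiDeriv.per (Function.invFun p.phi y) :=
      ((continuous_per _).comp (continuous_invFun_phi hp)).div
        ((continuous_per _).comp (continuous_invFun_phi hp))
        fun y => (mem_Kspace_iff.mp hp _).ne'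
    -- Evaluating A⁻¹∂ₓ at φ(x) and substituting gives -∫₀ˣ d + φ(x) ∫₀¹ d, which is minus the
    -- twisted primitive of d.
    rw [Function.comp_apply, christoffelId₁, density_compInv hp,
      invA_deriv (hasDerivAt_compInv hp (p.phiDerivInv * d)) hc, integral_compInv hp,
      integral_compInv_one hp, phiDeriv_mul_phiDerivInv_mul hp, per_fst, derivFst_christoffel,
      ← hd]
    simp only [per_smul, per_sub]
    rw [intervalIntegral.integral_const_mul,
      intervalIntegral.integral_sub (d.continuous_per.intervalIntegrable _ _)
        ((p.phiDeriv.continuous_per.intervalIntegrable _ _).const_mul _),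
      intervalIntegral.integral_const_mul, integral_phiDeriv]
    ring
  · obtain ⟨c, hc⟩ := repSnd_christoffel p (mk U₁ U₂) (mk V₁ V₂)
    refine ⟨_, mk_eq_snd hc, fun x => ?_⟩
    rw [Function.comp_apply, christoffelId₂, deriv_compInv hp U₁ U₂, deriv_compInv hp V₁ V₂,
      meanFree_compInv hp U₁ U₂, meanFree_compInv hp V₁ V₂, invFun_phi hp]
    simp only [per_smul, per_mul, per_phiDerivInv hp, per_crossTerm]
    ring

theorem isKTensorJ_tensorJ : IsKTensorJ s tensorJ := by
  intro p hp U₁ U₂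
  refine ⟨fun x => ?_, -(p.phiDerivInv * derivFst s (mk U₁ U₂)),
    mk_eq_snd (c := mean (s - 1) (p.phiDerivInv * derivFst s (mk U₁ U₂))) ?_, fun x => ?_⟩
  · beta_reduce
    rw [per_fst, derivFst_tensorJ, rep_mk, ← intervalIntegral.integral_neg]
    refine intervalIntegral.integral_congr fun y _ => ?_
    simp only [deriv_phi, per_neg, per_mul, per_sub, per_smul, per_one, mean_apply, mul_one,
      mul_comm (U₂.per _)]
    ring
  · rw [repSnd_tensorJ]
    abel
  · beta_reduce
    rw [deriv_phi, deriv_per, per_neg, per_mul, per_phiDerivInv hp, derivFst_mk, inv_mul_eq_div]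

/-- Integration by parts; the boundary terms vanish because V₁(0) = V₁(1) = 0. -/
theorem integral_deriv_mul (U₂ : SobolevH (s - 1)) (V₁ : sobolevZero s) :
    ∫ x in (0 : ℝ)..1, deriv U₂.per x * V₁.1.per x =
      -∫ x in (0 : ℝ)..1, U₂.per x * (derivL s V₁.1).per x := by
  have h0 : V₁.1.per 0 = 0 := V₁.2
  have h1 : V₁.1.per 1 = 0 := by
    have := V₁.1.per_add_one 0
    rwa [zero_add, h0] at this
  simp only [deriv_per]
  have h := intervalIntegral.integral_deriv_mul_eq_sub (a := 0) (b := 1)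
    (fun x _ => U₂.hasDerivAt_per x) (fun x _ => V₁.1.hasDerivAt_per x)
    ((continuous_per _).intervalIntegrable _ _) ((continuous_per _).intervalIntegrable _ _)
  have hi : ∀ {a b : ℝ} (f : SobolevH a) (g : SobolevH b),
      IntervalIntegrable (fun x => f.per x * g.per x) volume 0 1 := fun f g =>
    (f.continuous_per.mul g.continuous_per).intervalIntegrable _ _
  rw [h0, h1, mul_zero, mul_zero, sub_zero,
    intervalIntegral.integral_add (hi _ _) (hi _ _)] at h
  exact eq_neg_of_add_eq_zero_left h

theorem isKForm_form : IsKForm s fun _ => form s := by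
  intro p _ U₁ V₁ U₂ V₂
  have hi : ∀ (A : SobolevH (s - 1)) (B : sobolevZero s),
      IntervalIntegrable (fun x => deriv A.per x * B.1.per x) volume 0 1 := fun A B => by
    simp only [deriv_per]
    exact ((continuous_per _).mul (continuous_per _)).intervalIntegrable _ _
  have h : derivFst s (mk U₁ U₂) * repSnd s (mk V₁ V₂) -
      repSnd s (mk U₁ U₂) * derivFst s (mk V₁ V₂) =
      V₂ * derivL s U₁.1 - U₂ * derivL s V₁.1 - mean (s - 1) V₂ • derivL s U₁.1 +
        mean (s - 1) U₂ • derivL s V₁.1 := by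
    refine per_injective fun x => ?_
    simp only [derivFst_mk, repSnd_mk, per_sub, per_add, per_mul, per_smul, per_one]
    ring
  rw [form_apply, formBilin_apply, h, map_add, map_sub, map_sub, map_smul, map_smul, mean_derivL,
    mean_derivL, intervalIntegral.integral_sub (hi _ _) (hi _ _), integral_deriv_mul,
    integral_deriv_mul]
  simp only [mean_apply, per_mul, smul_zero]
  ring

end KModel

end

theorem theorem3p6 (s : ℝ) (hs : 5 / 2 < s) :
    IsOpen (Kspace s) ∧
    ∃ (g : KModel s → KModel s →L[ℝ] KModel s →L[ℝ] ℝ)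
      (Γ : KModel s → KModel s →L[ℝ] KModel s →L[ℝ] KModel s)
      (Ω : KModel s → KModel s [⋀^Fin 2]→L[ℝ] ℝ)
      (J : KModel s → KModel s →L[ℝ] KModel s),
      -- the tensors given by the formulas are well defined
      (IsKMetric s g ∧ IsKChristoffel s Γ ∧ IsKForm s Ω ∧ IsKTensorJ s J) ∧
      (IsPseudoRiemannianMetric (Kspace s) g ∧ ContDiffOn ℝ ∞ Γ (Kspace s) ∧
        IsMetricCompatible (Kspace s) Γ g) ∧
      (IsSymplecticForm (Kspace s) Ω ∧ IsParallelForm (Kspace s) Γ Ω) ∧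
      (ContDiffOn ℝ ∞ J (Kspace s) ∧ (∀ p ∈ Kspace s, ∀ U, J p (J p U) = U) ∧
        IsParallelTensor (Kspace s) Γ J) ∧
      (∀ p ∈ Kspace s, ∀ U V, Ω p ![U, V] = g p (J p U) V) ∧
      (∀ p ∈ Kspace s, ∀ U V, g p U V = -g p (J p U) (J p V)) ∧
      (∀ X Y : KModel s → KModel s, IsSmoothField (Kspace s) X → IsSmoothField (Kspace s) Y →
        ∀ p ∈ Kspace s, nijenhuis J X Y p = 0) := by
  have : Fact (5 / 2 < s) := ⟨hs⟩
  have hJJ : ∀ p ∈ Kspace s, ∀ U, KModel.tensorJ p (KModel.tensorJ p U) = U :=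
    fun p hp U => KModel.tensorJ_tensorJ hp U
  refine ⟨KModel.isOpen_Kspace, KModel.metric, KModel.christoffel, fun _ => KModel.form s,
    KModel.tensorJ,
    ⟨KModel.isKMetric_metric, KModel.isKChristoffel_christoffel, KModel.isKForm_form,
      KModel.isKTensorJ_tensorJ⟩,
    ⟨KModel.isPseudoRiemannianMetric_metric, KModel.contDiffOn_christoffel,
      isMetricCompatible_of_isParallel (fun _ _ _ => rfl) KModel.contDiffOn_tensorJ
        KModel.isParallelForm_form KModel.isParallelTensor_tensorJ⟩,
    ⟨KModel.isSymplecticForm_form, KModel.isParallelForm_form⟩,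
    ⟨KModel.contDiffOn_tensorJ, hJJ, KModel.isParallelTensor_tensorJ⟩,
    fun p hp U V => ?_, fun p hp U V => ?_, fun X Y hX hY p hp => ?_⟩
  · rw [KModel.metric_apply, hJJ p hp]
    rfl
  -- g(JU, JV) = ω(U, JV) = -ω(JV, U) = -g(V, U).
  · rw [KModel.metric_apply p (KModel.tensorJ p U), hJJ p hp, KModel.formBilin_neg,
      ← KModel.metric_apply, KModel.metric_symm hp, neg_neg]
  · exact nijenhuis_eq_zero_of_isParallelTensor KModel.contDiffOn_tensorJ hJJ
      (fun q hq => KModel.christoffel_symm hq) KModel.isParallelTensor_tensorJ hX hY hp
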